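/- Let $I=\mathbb{N}=\{0,1,2,\dots\}$ or $I=\mathbb{Z}$, and consider the birth and death chain on $I$ with birth rates $\lambda(x)>0$ and death rates $\mu(x)$, where $\mu(x)>0$ for all $x\in I$, except that $\mu(0)=0$ if $I=\mathbb{N}$ ($0$ is reflecting). Let $$\pi(x)=\prod_{i=1}^{x}\frac{\lambda(i-1)}{\mu(i)}\ (x\ge 0),\qquad \pi(x)=\prod_{i=1}^{-x}\frac{\mu(x+i)}{\lambda(x+i-1)}\ (x\le -1)$$ be its symmetrizing measure. Assume that the infinite boundary points are natural, that is: if $I=\mathbb{N}$, $$\sum_{j\ge 0}\frac{1}{\lambda(j)\pi(j)}\sum_{i=0}^{j}\pi(i)=\infty,\qquad \sum_{j\ge 0}\frac{1}{\lambda(j)\pi(j)}\sum_{i\ge j+1}\pi(i)=\infty;$$ if $I=\mathbb{Z}$, $$\sum_{j\ge 1}\frac{1}{\lambda(j)\pi(j)}\sum_{i=1}^{j}\pi(i)=\infty,\quad \sum_{j\ge 1}\pi(j)\sum_{i=1}^{j-1}\frac{1}{\lambda(i)\pi(i)}=\infty,\quad \sum_{j\le -1}\frac{1}{\lambda(j)\pi(j)}\sum_{i=j+1}^{-1}\pi(i)=\infty,\quad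 \sum_{j\le -1}\pi(j)\sum_{i=j}^{-1}\frac{1}{\lambda(i)\pi(i)}=\infty .$$ The Siegmund dual chain has birth rates $\hat\lambda(x)=\mu(x+1)$ and death rates $\hat\mu(x)=\lambda(x)$; if $I=\mathbb{N}$ it is killed when it jumps from $0$ to $-1$. Let $\hat\pi$ be given by the formula for $\pi$ with $(\hat\lambda,\hat\mu)$ in place of $(\lambda,\mu)$, and let $p_t(x,y)$ and $\hat p_t(x,y)$, $x,y\in I$, be the transition densities of the chain and of its dual. For $n\ge 0$ let $W^n=\{x\in I^n: x_1<\dots<x_n\}$ (a single point if $n=0$), and let $P^n_t$ and $\hat P^n_t$ be the kernels on $W^n$ with entries $\det(p_t(x_i,y_j))_{i,j=1}^n$ and $\det(\hat p_t(x_i,y_j))_{i,j=1}^n$. Define the positive kernels $$(\Lambda_{n,n+1}f)(x)=\sum_{y\prec x}\prod_{i=1}^n\hat\pi(y_i)\,f(y)\quad (x\in W^{n+1}),\qquad (\Lambda_{n,n}f)(x)=\sum_{y\prec x}\prod_{i=1}^n\pi(y_i)\,f(y)\quad (x\in W^{n}),$$ where in both sums $y\in W^n$, and $y\prec x$ means $x_1\le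 y_1<x_2\le\dots\le y_n<x_{n+1}$ in the first case and $y_1\le x_1<y_2\le\dots<y_n\le x_n$ in the second. Then, for all $n\ge 0$ and $t\ge 0$, the kernels $P^n_t$ and $\hat P^n_t$ are nonnegative with total masses at most $1$, and $$P_t^{n+1}\Lambda_{n,n+1}=\Lambda_{n,n+1}\hat P_t^{n},\qquad \hat P_t^{n}\Lambda_{n,n}=\Lambda_{n,n}P_t^{n}.$$ These are equalities of positive kernels: in each, the composed kernels on the two sides have finite entries, and the entries coincide. Moreover, for every real function $f$ on $W^n$ and every point $x$, the multiple sum defining one side applied to $f$ at $x$ converges absolutely if and only if the one defining the other side does, and in that case the two sides applied to $f$ agree at $x$. -/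

import Mathlib

open scoped ENNReal

noncomputable section

/-! ## Continuous-time chains with a given matrix of transition rates -/

/-- The matrix of transition rates of the birth and death chain on `I` (here `I` is `ℕ` or `ℤ`) with
birth rates `lam` and death rates `mu`. On `ℕ`, if `mu 0 ≠ 0` the chain is killed at rate `mu 0`
when it is at `0`: the first row then has negative sum `-mu 0`. -/
def bdGenerator {I : Type} [DecidableEq I] [Add I] [One I] (lam mu : I → ℝ) (x y : I) : ℝ :=
  if y = x + 1 then lam x
  else if y = x then -(lam x + mu x)
  else if x = y + 1 then mu x
  else 0

/-- Birth rates of the Siegmund dual: `x ↦ mu (x + 1)`. -/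
def dualBirth {I : Type} [Add I] [One I] (_lam mu : I → ℝ) (x : I) : ℝ := mu (x + 1)

/-- Death rates of the Siegmund dual: `x ↦ lam x`. -/
def dualDeath {I : Type} (lam _mu : I → ℝ) (x : I) : ℝ := lam x

/-- `jumpDensity Q k t x y` is the probability that the chain with rate matrix `Q`, started from `x`,
makes exactly `k` jumps during `[0, t]` and is at `y` at time `t`. The chain waits at `x` for an
exponential time of parameter `-Q x x`, and then jumps to `z ≠ x` with probability
`Q x z / (-Q x x)` (and is killed with the remaining probability). The recursion is the decomposition
according to the time `s` and the target `z` of the first jump. -/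
def jumpDensity {I : Type} [DecidableEq I] (Q : I → I → ℝ) : ℕ → ℝ → I → I → ℝ
  | 0, t, x, y => if x = y then Real.exp (Q x x * t) else 0
  | k + 1, t, x, y => ∫ s in (0 : ℝ)..t, Real.exp (Q x x * s) *
      ∑' z : I, (if z = x then 0 else Q x z) * jumpDensity Q k (t - s) z y

/-- The transition density `p_t(x, y) = ℙ_x(X(t) = y)` of the chain with rate matrix `Q`
(the chain is sent to a cemetery if it explodes). -/
def transitionDensity {I : Type} [DecidableEq I] (Q : I → I → ℝ) (t : ℝ) (x y : I) : ℝ :=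
  ∑' k : ℕ, jumpDensity Q k t x y

/-- Transition density of the birth and death chain with rates `lam`, `mu`. -/
def bdDensity {I : Type} [DecidableEq I] [Add I] [One I] (lam mu : I → ℝ) : ℝ → I → I → ℝ :=
  transitionDensity (bdGenerator lam mu)

/-- Transition density of the Siegmund dual of the chain with rates `lam`, `mu`. On `ℕ` the dual is
absorbed at `-1`, and this is its density on `ℕ`, that is, that of the dual killed at `-1`. -/
def dualDensity {I : Type} [DecidableEq I] [Add I] [One I] (lam mu : I → ℝ) : ℝ → I → I → ℝ :=
  transitionDensity (bdGenerator (dualBirth lam mu) (dualDeath lam mu))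

/-! ## Symmetrizing measures and standing assumptions -/

/-- Symmetrizing measure on `ℕ`: `π(x) = ∏_{i=1}^x lam (i-1) / mu i`. -/
def natSymm (lam mu : ℕ → ℝ) (x : ℕ) : ℝ :=
  ∏ i ∈ Finset.range x, lam i / mu (i + 1)

/-- Symmetrizing measure on `ℤ`: `π(x) = ∏_{i=1}^x lam (i-1) / mu i` for `x ≥ 0` and
`π(x) = ∏_{i=1}^{-x} mu (x+i) / lam (x+i-1)` for `x ≤ -1`. -/
def intSymm (lam mu : ℤ → ℝ) (x : ℤ) : ℝ :=
  if 0 ≤ x then ∏ i ∈ Finset.range x.toNat, lam (i : ℤ) / mu ((i : ℤ) + 1)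
  else ∏ i ∈ Finset.range (-x).toNat, mu (x + (i : ℤ) + 1) / lam (x + (i : ℤ))

/-- Symmetrizing measure of the dual chain on `ℕ`. -/
def natSymmDual (lam mu : ℕ → ℝ) : ℕ → ℝ := natSymm (dualBirth lam mu) (dualDeath lam mu)

/-- Symmetrizing measure of the dual chain on `ℤ`. -/
def intSymmDual (lam mu : ℤ → ℝ) : ℤ → ℝ := intSymm (dualBirth lam mu) (dualDeath lam mu)

/-- Birth and death chains on `ℕ`, reflecting at `0`, for which `∞` is a natural boundary point. -/
structure IsNatChain (lam mu : ℕ → ℝ) : Prop where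
  lam_pos : ∀ x, 0 < lam x
  mu_zero : mu 0 = 0
  mu_pos : ∀ x, 1 ≤ x → 0 < mu x
  not_exit : ∑' j : ℕ, ENNReal.ofReal (1 / (lam j * natSymm lam mu j)) *
      ∑ i ∈ Finset.range (j + 1), ENNReal.ofReal (natSymm lam mu i) = ∞
  not_entrance : ∑' j : ℕ, ENNReal.ofReal (1 / (lam j * natSymm lam mu j)) *
      ∑' i : ℕ, ENNReal.ofReal (natSymm lam mu (j + 1 + i)) = ∞

/-- Bilateral birth and death chains, for which `∞` and `-∞` are natural boundary points. The outer
sums run over `j = 1, 2, …` at `+∞`, and over `-1, -2, …` (written as `-j`) at `-∞`. -/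
structure IsIntChain (lam mu : ℤ → ℝ) : Prop where
  lam_pos : ∀ x, 0 < lam x
  mu_pos : ∀ x, 0 < mu x
  not_exit_top : ∑' j : {j : ℤ // 1 ≤ j}, ENNReal.ofReal (1 / (lam j * intSymm lam mu j)) *
      ∑ i ∈ Finset.Icc (1 : ℤ) j, ENNReal.ofReal (intSymm lam mu i) = ∞
  not_entrance_top : ∑' j : {j : ℤ // 1 ≤ j}, ENNReal.ofReal (intSymm lam mu j) *
      ∑ i ∈ Finset.Icc (1 : ℤ) (j - 1), ENNReal.ofReal (1 / (lam i * intSymm lam mu i)) = ∞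
  not_exit_bot : ∑' j : {j : ℤ // j ≤ -1}, ENNReal.ofReal (1 / (lam j * intSymm lam mu j)) *
      ∑ i ∈ Finset.Icc ((j : ℤ) + 1) (-1), ENNReal.ofReal (intSymm lam mu i) = ∞
  not_entrance_bot : ∑' j : {j : ℤ // j ≤ -1}, ENNReal.ofReal (intSymm lam mu j) *
      ∑ i ∈ Finset.Icc (j : ℤ) (-1), ENNReal.ofReal (1 / (lam i * intSymm lam mu i)) = ∞

/-! ## Weyl chambers, Karlin-McGregor kernels and interlacing kernels -/

/-- `W^n(I)`: strictly increasing `n`-tuples. -/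
def Weyl (I : Type) [LinearOrder I] (n : ℕ) : Type := {x : Fin n → I // StrictMono x}

/-- The Karlin-McGregor kernel `det (p_t(x_i, y_j))` on `W^n(I)`. -/
def karlinMcGregor {I : Type} [LinearOrder I] (p : ℝ → I → I → ℝ) (n : ℕ) (t : ℝ)
    (x y : Weyl I n) : ℝ :=
  (Matrix.of fun i j : Fin n => p t (x.1 i) (y.1 j)).det

/-- `x_1 ≤ y_1 < x_2 ≤ y_2 < ⋯ ≤ y_n < x_{n+1}`. -/
def InterlaceSucc {I : Type} [LinearOrder I] {n : ℕ} (x : Weyl I (n + 1)) (y : Weyl I n) : Prop :=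
  ∀ i : Fin n, x.1 i.castSucc ≤ y.1 i ∧ y.1 i < x.1 i.succ

/-- `y_1 ≤ x_1 < y_2 ≤ x_2 < ⋯ < y_n ≤ x_n`. -/
def InterlaceSame {I : Type} [LinearOrder I] {n : ℕ} (x y : Weyl I n) : Prop :=
  (∀ i : Fin n, y.1 i ≤ x.1 i) ∧ ∀ i j : Fin n, (j : ℕ) = (i : ℕ) + 1 → x.1 i < y.1 j

open Classical in
/-- The kernel `1(y ≺ x) ∏ w(y_i)` from `W^{n+1}` to `W^n`. It is `Λ_{n,n+1}` when `w` is the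
symmetrizing measure of the dual chain. -/
def lambdaSucc {I : Type} [LinearOrder I] (w : I → ℝ) (n : ℕ) (x : Weyl I (n + 1))
    (y : Weyl I n) : ℝ :=
  if InterlaceSucc x y then ∏ i : Fin n, w (y.1 i) else 0

open Classical in
/-- The kernel `1(y ≺ x) ∏ w(y_i)` from `W^n` to `W^n`. It is `Λ_{n,n}` when `w` is the symmetrizing
measure of the chain. -/
def lambdaSame {I : Type} [LinearOrder I] (w : I → ℝ) (n : ℕ) (x y : Weyl I n) : ℝ :=
  if InterlaceSame x y then ∏ i : Fin n, w (y.1 i) else 0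

/-! ## Kernels as operators, and equality of compositions of kernels -/

/-- The operator `(K f)(x) = ∑_y K(x, y) f(y)`. -/
def kernelOp {α β : Type} (K : α → β → ℝ) (f : β → ℝ) (x : α) : ℝ := ∑' y, K x y * f y

/-- Nonnegative kernels with total masses at most one. -/
def IsSubMarkovKernel {α β : Type} (K : α → β → ℝ) : Prop :=
  (∀ x y, 0 ≤ K x y) ∧ ∀ x, Summable (K x) ∧ ∑' y, K x y ≤ 1

/-- The relation `A B = C D` between compositions of kernels: the composed kernels have finite
entries and these coincide, and as operators `A B` and `C D` have at every point the same absolutely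
summable functions, on which they coincide. -/
structure KernelsIntertwine {α β γ δ : Type} (A : α → β → ℝ) (B : β → γ → ℝ)
    (C : α → δ → ℝ) (D : δ → γ → ℝ) : Prop where
  summable_left : ∀ x z, Summable fun y => A x y * B y z
  summable_right : ∀ x z, Summable fun y => C x y * D y z
  entry_eq : ∀ x z, ∑' y, A x y * B y z = ∑' y, C x y * D y z
  summable_iff : ∀ (f : γ → ℝ) (x : α),
    (Summable fun q : β × γ => A x q.1 * B q.1 q.2 * f q.2) ↔
      Summable fun q : δ × γ => C x q.1 * D q.1 q.2 * f q.2
  op_eq : ∀ (f : γ → ℝ) (x : α),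
    (Summable fun q : δ × γ => C x q.1 * D q.1 q.2 * f q.2) →
      kernelOp A (kernelOp B f) x = kernelOp C (kernelOp D f) x

end

/-!
# Intertwining of Karlin–McGregor semigroups by Siegmund duality

Both relations come from one-particle duality. Let `F(x, z) = ∑_{u ≤ z} p_t(x, u)`. Siegmund duality
says `F(x, z) = ∑_{u ≥ x} p̂_t(z, u)`. The entries of each composed kernel are sums of determinants
over a product of disjoint intervals (the interlacing condition), so they are determinants of sums of
transition densities over intervals. Reversibility puts the summation variables on the side of the end
points where necessary, and elementary row and column operations turn the two sides into the same
determinant: `det (F(x_j, z_i) - F(x_{j+1}, z_i))` for `Λ_{n,n+1}`, where the missing column is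
`F(x, ∞) = 1`, and `det F(z_i, x_j)` for `Λ_{n,n}` (`hasSum_det_interlaceSucc` and the similar lemmas
after it). Since all kernels are nonnegative, Tonelli and Fubini extend the equality of entries to
functions (`kernelsIntertwine_of_hasSum`).

The facts about one chain are proved for a rate matrix `Q` with finite rows on an arbitrary set of
states, under the existence of a Lyapunov function: `f ≥ 0` with `Q f ≤ f` and finite sublevel sets.
The transition density, defined by summation over the number of jumps, is a bounded solution of
Kolmogorov's backward equation (`IsRateMatrix.hasDerivAt_transitionDensity`), and the Lyapunov function
gives a comparison principle for bounded subsolutions (`IsLyapunov.le_of_subsolution`). It yields: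

* conservation of mass, since `1 - ∑_{y ∈ A} p_t(x, y)` starts below `ε f` for suitable finite `A`;
* convergence of the chain truncated to a finite set of states, whose density is a matrix exponential
  and therefore reversible and a solution of the forward equation;
* duality of transition densities from duality of the rate matrices, since by the forward equation the
  truncated left-hand side is a subsolution of the backward equation of the right-hand side
  (`sum_truncatedDensity_mul_le`), and the two chains play symmetric roles;
* nonnegativity and total mass at most one of the Karlin–McGregor determinants, by the same principle
  in the Weyl chamber, which nearest-neighbour chains leave only through points with two equal
  coordinates, where the determinants vanish (`nonneg_of_supersolution_chamber`).

For birth and death chains, the Lyapunov functions are the partial sums of the series that diverge by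
assumption: the non-exit series for the chain and the non-entrance series for its dual, whose
symmetrizing measure and scale are, up to constants, the scale and symmetrizing measure of the chain.
-/

open Filter Topology Set

/-! ### Minimum principles -/

/-- A family of functions that is nonnegative at time `0`, nonnegative outside a finite set of indices,
and whose derivative is nonnegative wherever the family has a negative minimum over the indices,
stays nonnegative: otherwise `w v t + η t` has, for small `η > 0`, a negative minimum over a compact
set of times, at which its derivative would be both `≤ 0` and `≥ η`. -/
theorem nonneg_of_deriv_nonneg_at_min {V : Type*} (w w' : V → ℝ → ℝ) {K : Set V} (hK : K.Finite)
    (hcont : ∀ v, ContinuousOn (w v) (Ici 0))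
    (hderiv : ∀ v t, 0 < t → HasDerivAt (w v) (w' v t) t)
    (hinit : ∀ v, 0 ≤ w v 0)
    (hout : ∀ v, v ∉ K → ∀ t, 0 ≤ t → 0 ≤ w v t)
    (hmin : ∀ v t, 0 < t → w v t < 0 → (∀ u, w v t ≤ w u t) → 0 ≤ w' v t) :
    ∀ v t, 0 ≤ t → 0 ≤ w v t := by
  intro v₀ T hT
  by_contra! hneg
  have hT' : 0 < T := by
    rcases hT.lt_or_eq with h | h
    · exact h
    · subst h
      exact absurd (hinit v₀) (not_le.2 hneg)
  have hv₀ : v₀ ∈ K := by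
    by_contra h
    exact absurd (hout v₀ h T hT) (not_le.2 hneg)
  set η : ℝ := -(w v₀ T) / (2 * T) with hη
  have hηpos : 0 < η := div_pos (by linarith) (by linarith)
  have hηT : η * T = -(w v₀ T) / 2 := by rw [hη]; field_simp
  have hloc : ∀ v, ∃ s ∈ Icc 0 T, ∀ t ∈ Icc 0 T, w v s + η * s ≤ w v t + η * t := fun v =>
    isCompact_Icc.exists_isMinOn ⟨0, left_mem_Icc.2 hT⟩
      (((hcont v).mono Icc_subset_Ici_self).add (continuous_const.mul continuous_id).continuousOn)
  choose s hs hsmin using hloc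
  obtain ⟨v, hvK, hv⟩ := hK.exists_minimalFor (fun v => w v (s v) + η * s v) K ⟨v₀, hv₀⟩
  have hv : ∀ u ∈ K, w v (s v) + η * s v ≤ w u (s u) + η * s u := fun u hu =>
    (le_total (w v (s v) + η * s v) (w u (s u) + η * s u)).elim id (fun h => hv hu h)
  have hval : w v (s v) + η * s v < 0 := by
    have h1 := hv v₀ hv₀
    have h2 := hsmin v₀ T ⟨hT, le_rfl⟩
    linarith
  have hηs : 0 ≤ η * s v := mul_nonneg hηpos.le (hs v).1
  have hwneg : w v (s v) < 0 := by linarith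
  have hspos : 0 < s v := by
    rcases (hs v).1.lt_or_eq with h | h
    · exact h
    · rw [← h] at hwneg
      exact absurd (hinit v) (not_le.2 hwneg)
  have hall : ∀ u, w v (s v) ≤ w u (s v) := by
    intro u
    by_cases hu : u ∈ K
    · have h1 := hv u hu
      have h2 := hsmin u (s v) (hs v)
      linarith
    · exact hwneg.le.trans (hout u hu _ (hs v).1)
  have hd := hmin v (s v) hspos hwneg hall
  have hD : HasDerivAt (fun t => w v t + η * t) (w' v (s v) + η * 1) (s v) :=
    (hderiv v _ hspos).add ((hasDerivAt_id _).const_mul η)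
  have hle : w' v (s v) + η * 1 ≤ 0 := by
    refine le_of_tendsto (hD.tendsto_slope.mono_left
      (nhdsWithin_mono _ (fun x hx => ne_of_lt hx : Iio (s v) ⊆ {s v}ᶜ))) ?_
    filter_upwards [Ioo_mem_nhdsLT hspos] with t ht
    rw [slope_def_field]
    exact div_nonpos_of_nonneg_of_nonpos
      (by linarith [hsmin v t ⟨ht.1.le, ht.2.le.trans (hs v).2⟩]) (by linarith [ht.2])
  linarith

/-- `Q` is a matrix of transition rates in which the row of `x` is supported by the finite set `N x`:
off-diagonal entries are nonnegative and row sums are at most `0` (a negative sum is a killing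
rate). -/
structure IsRateMatrix {I : Type} (Q : I → I → ℝ) (N : I → Finset I) : Prop where
  self_mem : ∀ x, x ∈ N x
  eq_zero : ∀ x z, z ∉ N x → Q x z = 0
  offdiag_nonneg : ∀ x z, z ≠ x → 0 ≤ Q x z
  row_sum_nonpos : ∀ x, ∑ z ∈ N x, Q x z ≤ 0

/-- A nonnegative function `f` with finite sublevel sets and `Q f ≤ f`. Its existence excludes
explosion. -/
structure IsLyapunov {I : Type} (Q : I → I → ℝ) (N : I → Finset I) (f : I → ℝ) : Prop where
  nonneg : ∀ x, 0 ≤ f x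
  drift : ∀ x, ∑ z ∈ N x, Q x z * f z ≤ f x
  finite_le : ∀ c, {x | f x ≤ c}.Finite

theorem IsRateMatrix.sum_mul_nonneg_of_min {I : Type} {Q : I → I → ℝ} {N : I → Finset I}
    (hQ : IsRateMatrix Q N) {x : I} {a : I → ℝ} (hneg : a x ≤ 0) (hmin : ∀ z ∈ N x, a x ≤ a z) :
    0 ≤ ∑ z ∈ N x, Q x z * a z := by
  have h1 : (∑ z ∈ N x, Q x z) * a x ≤ ∑ z ∈ N x, Q x z * a z := by
    rw [Finset.sum_mul]
    refine Finset.sum_le_sum fun z hz => ?_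
    rcases eq_or_ne z x with rfl | hzx
    · exact le_rfl
    · exact mul_le_mul_of_nonneg_left (hmin z hz) (hQ.offdiag_nonneg x z hzx)
  exact (mul_nonneg_of_nonpos_of_nonpos (hQ.row_sum_nonpos x) hneg).trans h1

/-- Comparison principle: a subsolution of the backward equation that is bounded above and starts
below `ε f`, where `f` is a Lyapunov function, stays below `ε eᵗ f`. -/
theorem IsLyapunov.le_of_subsolution {I : Type} {Q : I → I → ℝ} {N : I → Finset I} {f : I → ℝ}
    (hf : IsLyapunov Q N f) (hQ : IsRateMatrix Q N) {u u' : I → ℝ → ℝ} {C ε : ℝ} (hε : 0 ≤ ε)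
    (hcont : ∀ x, ContinuousOn (u x) (Ici 0))
    (hderiv : ∀ x t, 0 < t → HasDerivAt (u x) (u' x t) t)
    (hbound : ∀ x t, 0 ≤ t → u x t ≤ C)
    (hsub : ∀ x t, 0 < t → u' x t ≤ ∑ z ∈ N x, Q x z * u z t)
    (hinit : ∀ x, u x 0 ≤ ε * f x) {t : ℝ} (ht : 0 ≤ t) (x : I) :
    u x t ≤ ε * Real.exp t * f x := by
  have key : ∀ δ > 0, 0 ≤ (ε + δ) * Real.exp t * f x - u x t := by
    intro δ hδ
    refine nonneg_of_deriv_nonneg_at_min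
      (fun v s => (ε + δ) * Real.exp s * f v - u v s)
      (fun v s => (ε + δ) * Real.exp s * f v - u' v s)
      (hf.finite_le (C / δ)) ?_ ?_ ?_ ?_ ?_ x t ht
    · exact fun v => (Continuous.continuousOn (by fun_prop)).sub (hcont v)
    · exact fun v s hs => (((Real.hasDerivAt_exp s).const_mul _).mul_const _).sub (hderiv v s hs)
    · intro v
      have := hinit v
      have := mul_nonneg hδ.le (hf.nonneg v)
      simp only [Real.exp_zero]
      linarith
    · intro v hv s hs
      simp only [mem_ofPred_eq, not_le, div_lt_iff₀ hδ] at hv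
      have h1 := hbound v s hs
      have h2 : 1 ≤ Real.exp s := Real.one_le_exp hs
      have h3 : δ * f v ≤ (ε + δ) * Real.exp s * f v := by
        refine mul_le_mul_of_nonneg_right ?_ (hf.nonneg v)
        nlinarith
      linarith
    · intro v s hs hneg hmin
      have h1 := hQ.sum_mul_nonneg_of_min (x := v)
        (a := fun z => (ε + δ) * Real.exp s * f z - u z s) hneg.le (fun z _ => hmin z)
      have h2 : ∑ z ∈ N v, Q v z * ((ε + δ) * Real.exp s * f z - u z s)
          = (ε + δ) * Real.exp s * ∑ z ∈ N v, Q v z * f z - ∑ z ∈ N v, Q v z * u z s := by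
        rw [Finset.mul_sum, ← Finset.sum_sub_distrib]
        exact Finset.sum_congr rfl fun z _ => by ring
      have h3 := mul_le_mul_of_nonneg_left (hf.drift v)
        (by positivity : 0 ≤ (ε + δ) * Real.exp s)
      have h4 := hsub v s hs
      linarith
  have hlim : Tendsto (fun δ : ℝ => (ε + δ) * Real.exp t * f x - u x t) (𝓝[>] 0)
      (𝓝 ((ε + 0) * Real.exp t * f x - u x t)) :=
    (Continuous.tendsto (by fun_prop) 0).mono_left nhdsWithin_le_nhds
  have := ge_of_tendsto hlim (eventually_nhdsWithin_of_forall fun δ hδ => key δ hδ)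
  rw [add_zero] at this
  linarith

theorem IsLyapunov.exists_finset {I : Type} {Q : I → I → ℝ} {N : I → Finset I} {f : I → ℝ}
    (hf : IsLyapunov Q N f) {ε : ℝ} (hε : 0 < ε) :
    ∃ A : Finset I, ∀ x, x ∉ A → 1 ≤ ε * f x := by
  refine ⟨(hf.finite_le (1 / ε)).toFinset, fun x hx => ?_⟩
  simp only [Finite.mem_toFinset, mem_ofPred_eq, not_le, div_lt_iff₀ hε] at hx
  linarith

/-! ### The transition density as a solution of the backward equation -/

/-- The rates of the jumps away from `x`: the matrix `Q` with its diagonal replaced by `0`. -/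
def offDiagRate {I : Type} [DecidableEq I] (Q : I → I → ℝ) (x z : I) : ℝ :=
  if z = x then 0 else Q x z

theorem jumpDensity_succ_def {I : Type} [DecidableEq I] (Q : I → I → ℝ) (k : ℕ) (t : ℝ) (x y : I) :
    jumpDensity Q (k + 1) t x y = ∫ s in (0 : ℝ)..t, Real.exp (Q x x * s) *
      ∑' z : I, offDiagRate Q x z * jumpDensity Q k (t - s) z y := rfl

theorem transitionDensity_zero {I : Type} [DecidableEq I] (Q : I → I → ℝ) (x y : I) :
    transitionDensity Q 0 x y = if x = y then 1 else 0 := by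
  rw [transitionDensity, tsum_eq_single 0]
  · simp [jumpDensity]
  · intro k hk
    obtain ⟨k, rfl⟩ := Nat.exists_eq_succ_of_ne_zero hk
    simp [jumpDensity_succ_def]

namespace IsRateMatrix

variable {I : Type} [DecidableEq I] {Q : I → I → ℝ} {N : I → Finset I}

theorem offDiagRate_nonneg (hQ : IsRateMatrix Q N) (x z : I) : 0 ≤ offDiagRate Q x z := by
  unfold offDiagRate
  split_ifs with h
  · exact le_rfl
  · exact hQ.offdiag_nonneg x z h

theorem sum_eq_diag_add (hQ : IsRateMatrix Q N) (x : I) (a : I → ℝ) :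
    ∑ z ∈ N x, Q x z * a z = Q x x * a x + ∑ z ∈ N x, offDiagRate Q x z * a z := by
  rw [← Finset.add_sum_erase _ _ (hQ.self_mem x), ← Finset.add_sum_erase (N x)
    (fun z => offDiagRate Q x z * a z) (hQ.self_mem x)]
  simp only [offDiagRate, if_true, zero_mul, zero_add]
  congr 1
  refine Finset.sum_congr rfl fun z hz => ?_
  rw [if_neg (Finset.ne_of_mem_erase hz)]

theorem sum_offDiagRate_le (hQ : IsRateMatrix Q N) (x : I) :
    ∑ z ∈ N x, offDiagRate Q x z ≤ -Q x x := by
  have h := hQ.sum_eq_diag_add x (fun _ => 1)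
  simp only [mul_one] at h
  linarith [hQ.row_sum_nonpos x]

theorem tsum_offDiagRate_mul (hQ : IsRateMatrix Q N) (x : I) (a : I → ℝ) :
    ∑' z, offDiagRate Q x z * a z = ∑ z ∈ N x, offDiagRate Q x z * a z := by
  refine tsum_eq_sum fun z hz => ?_
  simp [offDiagRate, hQ.eq_zero x z hz]

/-- The first-jump decomposition, in terms of the time `r` that remains after the first jump. -/
theorem jumpDensity_succ (hQ : IsRateMatrix Q N) (k : ℕ) (t : ℝ) (x y : I) :
    jumpDensity Q (k + 1) t x y = Real.exp (Q x x * t) * ∫ r in (0 : ℝ)..t,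
      Real.exp (-(Q x x * r)) * ∑ z ∈ N x, offDiagRate Q x z * jumpDensity Q k r z y := by
  rw [jumpDensity_succ_def, ← intervalIntegral.integral_const_mul]
  have h := intervalIntegral.integral_comp_sub_left (a := 0) (b := t)
    (fun r => Real.exp (Q x x * t) * (Real.exp (-(Q x x * r)) *
      ∑ z ∈ N x, offDiagRate Q x z * jumpDensity Q k r z y)) t
  rw [sub_self, sub_zero] at h
  rw [← h]
  refine intervalIntegral.integral_congr fun s _ => ?_
  simp only [hQ.tsum_offDiagRate_mul]
  rw [← mul_assoc, ← Real.exp_add]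
  ring_nf

theorem continuous_jumpDensity (hQ : IsRateMatrix Q N) (k : ℕ) (x y : I) :
    Continuous fun t => jumpDensity Q k t x y := by
  induction k generalizing x with
  | zero =>
    simp only [jumpDensity]
    split_ifs <;> fun_prop
  | succ k ih =>
    simp only [hQ.jumpDensity_succ]
    refine (by fun_prop : Continuous fun t => Real.exp (Q x x * t)).mul
      (intervalIntegral.continuous_primitive (fun a b => Continuous.intervalIntegrable ?_ a b) 0)
    fun_prop

theorem jumpDensity_nonneg (hQ : IsRateMatrix Q N) (k : ℕ) {t : ℝ} (ht : 0 ≤ t) (x y : I) :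
    0 ≤ jumpDensity Q k t x y := by
  induction k generalizing x t with
  | zero =>
    simp only [jumpDensity]
    split_ifs <;> positivity
  | succ k ih =>
    rw [hQ.jumpDensity_succ]
    refine mul_nonneg (Real.exp_nonneg _) (intervalIntegral.integral_nonneg ht fun r hr => ?_)
    exact mul_nonneg (Real.exp_nonneg _) (Finset.sum_nonneg fun z _ =>
      mul_nonneg (hQ.offDiagRate_nonneg x z) (ih hr.1 z))

theorem sum_jumpDensity_succ (hQ : IsRateMatrix Q N) (K : ℕ) (t : ℝ) (x y : I) :
    ∑ k ∈ Finset.range (K + 1), jumpDensity Q k t x y =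
      Real.exp (Q x x * t) * ((if x = y then 1 else 0) + ∫ r in (0 : ℝ)..t,
        Real.exp (-(Q x x * r)) * ∑ z ∈ N x, offDiagRate Q x z *
          ∑ k ∈ Finset.range K, jumpDensity Q k r z y) := by
  rw [Finset.sum_range_succ', mul_add, add_comm]
  congr 1
  · simp only [jumpDensity]
    split_ifs <;> simp
  · simp only [hQ.jumpDensity_succ]
    rw [← Finset.mul_sum, ← intervalIntegral.integral_finsetSum]
    · congr 1
      refine intervalIntegral.integral_congr fun r _ => ?_
      simp only [Finset.mul_sum]
      exact Finset.sum_comm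
    · intro k _
      refine Continuous.intervalIntegrable ?_ _ _
      have := fun z => hQ.continuous_jumpDensity k z y
      fun_prop

theorem sum_jumpDensity_le_one (hQ : IsRateMatrix Q N) (K : ℕ) {t : ℝ} (ht : 0 ≤ t) (x y : I) :
    ∑ k ∈ Finset.range K, jumpDensity Q k t x y ≤ 1 := by
  induction K generalizing x t with
  | zero => simp
  | succ K ih =>
    rw [hQ.sum_jumpDensity_succ]
    have hcont : Continuous fun r => Real.exp (-(Q x x * r)) * ∑ z ∈ N x, offDiagRate Q x z *
        ∑ k ∈ Finset.range K, jumpDensity Q k r z y := by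
      have := fun k z => hQ.continuous_jumpDensity k z y
      fun_prop
    have hle : ∫ r in (0 : ℝ)..t, Real.exp (-(Q x x * r)) * ∑ z ∈ N x, offDiagRate Q x z *
        ∑ k ∈ Finset.range K, jumpDensity Q k r z y ≤
        ∫ r in (0 : ℝ)..t, Real.exp (-(Q x x * r)) * (-Q x x) := by
      refine intervalIntegral.integral_mono_on ht (hcont.intervalIntegrable _ _)
        (Continuous.intervalIntegrable (by fun_prop) _ _) fun r hr => ?_
      refine mul_le_mul_of_nonneg_left (le_trans ?_ (hQ.sum_offDiagRate_le x)) (Real.exp_nonneg _)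
      refine Finset.sum_le_sum fun z _ => ?_
      exact mul_le_of_le_one_right (hQ.offDiagRate_nonneg x z) (ih hr.1 z)
    have hint : ∫ r in (0 : ℝ)..t, Real.exp (-(Q x x * r)) * (-Q x x)
        = Real.exp (-(Q x x * t)) - 1 := by
      rw [intervalIntegral.integral_eq_sub_of_hasDerivAt
        (f := fun r => Real.exp (-(Q x x * r))) (fun r _ => ?_)
        (Continuous.intervalIntegrable (by fun_prop) _ _)]
      · simp
      · simpa using (((hasDerivAt_id r).const_mul (Q x x)).neg).exp
    have hδ : (if x = y then (1 : ℝ) else 0) ≤ 1 := by split_ifs <;> norm_num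
    calc _ ≤ Real.exp (Q x x * t) * (1 + (Real.exp (-(Q x x * t)) - 1)) :=
          mul_le_mul_of_nonneg_left (by linarith) (Real.exp_nonneg _)
      _ = 1 := by rw [add_sub_cancel, ← Real.exp_add, add_neg_cancel, Real.exp_zero]

theorem hasSum_jumpDensity (hQ : IsRateMatrix Q N) {t : ℝ} (ht : 0 ≤ t) (x y : I) :
    HasSum (fun k => jumpDensity Q k t x y) (transitionDensity Q t x y) :=
  (summable_of_sum_range_le (fun k => hQ.jumpDensity_nonneg k ht x y)
    fun K => hQ.sum_jumpDensity_le_one K ht x y).hasSum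

theorem transitionDensity_nonneg (hQ : IsRateMatrix Q N) {t : ℝ} (ht : 0 ≤ t) (x y : I) :
    0 ≤ transitionDensity Q t x y :=
  tsum_nonneg fun k => hQ.jumpDensity_nonneg k ht x y

theorem transitionDensity_le_one (hQ : IsRateMatrix Q N) {t : ℝ} (ht : 0 ≤ t) (x y : I) :
    transitionDensity Q t x y ≤ 1 :=
  le_of_tendsto' (hQ.hasSum_jumpDensity ht x y).tendsto_sum_nat
    fun K => hQ.sum_jumpDensity_le_one K ht x y

theorem measurable_transitionDensity (hQ : IsRateMatrix Q N) (x y : I) :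
    Measurable fun t => transitionDensity Q t x y := by
  unfold transitionDensity
  exact Measurable.tsum fun k => (hQ.continuous_jumpDensity k x y).measurable

/-- The integrand of the integrated backward equation, frozen at its value at `0` for negative times,
where the transition density has no meaning. -/
noncomputable def backwardIntegrand (Q : I → I → ℝ) (N : I → Finset I) (x y : I) (r : ℝ) : ℝ :=
  Real.exp (-(Q x x * r)) * ∑ z ∈ N x, offDiagRate Q x z * transitionDensity Q (max r 0) z y

theorem intervalIntegrable_backwardIntegrand (hQ : IsRateMatrix Q N) (x y : I) (a b : ℝ) :
    IntervalIntegrable (backwardIntegrand Q N x y) MeasureTheory.volume a b := by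
  have hb : IntervalIntegrable (fun r => Real.exp (-(Q x x * r)) * ∑ z ∈ N x, offDiagRate Q x z)
      MeasureTheory.volume a b := Continuous.intervalIntegrable (by fun_prop) a b
  refine hb.mono_fun ?_ ?_
  · refine Measurable.aestronglyMeasurable ?_
    have := fun z => (hQ.measurable_transitionDensity z y).comp
      (measurable_id.max (measurable_const (a := (0 : ℝ))))
    simp only [Function.comp_def, id] at this
    unfold backwardIntegrand
    fun_prop
  · refine Eventually.of_forall fun r => ?_
    have h0 : 0 ≤ max r 0 := le_max_right _ _
    have h1 : 0 ≤ ∑ z ∈ N x, offDiagRate Q x z * transitionDensity Q (max r 0) z y :=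
      Finset.sum_nonneg fun z _ =>
        mul_nonneg (hQ.offDiagRate_nonneg x z) (hQ.transitionDensity_nonneg h0 z y)
    simp only [backwardIntegrand]
    rw [Real.norm_of_nonneg (mul_nonneg (Real.exp_nonneg _) h1),
      Real.norm_of_nonneg (mul_nonneg (Real.exp_nonneg _)
        (Finset.sum_nonneg fun z _ => hQ.offDiagRate_nonneg x z))]
    refine mul_le_mul_of_nonneg_left (Finset.sum_le_sum fun z _ => ?_) (Real.exp_nonneg _)
    exact mul_le_of_le_one_right (hQ.offDiagRate_nonneg x z) (hQ.transitionDensity_le_one h0 z y)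

/-- The integrated backward equation. -/
theorem transitionDensity_eq_integral (hQ : IsRateMatrix Q N) {t : ℝ} (ht : 0 ≤ t) (x y : I) :
    transitionDensity Q t x y = Real.exp (Q x x * t) *
      ((if x = y then 1 else 0) + ∫ r in (0 : ℝ)..t, backwardIntegrand Q N x y r) := by
  have h1 : Tendsto (fun K => ∑ k ∈ Finset.range (K + 1), jumpDensity Q k t x y) atTop
      (𝓝 (transitionDensity Q t x y)) :=
    (hQ.hasSum_jumpDensity ht x y).tendsto_sum_nat.comp (tendsto_add_atTop_nat 1)
  refine tendsto_nhds_unique h1 ?_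
  simp only [hQ.sum_jumpDensity_succ]
  refine (tendsto_const_nhds.add ?_).const_mul _
  have hcont : ∀ K, Continuous fun r => Real.exp (-(Q x x * r)) * ∑ z ∈ N x, offDiagRate Q x z *
      ∑ k ∈ Finset.range K, jumpDensity Q k r z y := by
    intro K
    have := fun k z => hQ.continuous_jumpDensity k z y
    fun_prop
  refine intervalIntegral.tendsto_integral_filter_of_dominated_convergence
    (fun r => Real.exp (-(Q x x * r)) * ∑ z ∈ N x, offDiagRate Q x z)
    (Eventually.of_forall fun K => (hcont K).aestronglyMeasurable)
    (Eventually.of_forall fun K => Eventually.of_forall fun r hr => ?_)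
    (Continuous.intervalIntegrable (by fun_prop) _ _)
    (Eventually.of_forall fun r hr => ?_)
  · rw [uIoc_of_le ht] at hr
    have h2 : 0 ≤ ∑ z ∈ N x, offDiagRate Q x z * ∑ k ∈ Finset.range K, jumpDensity Q k r z y :=
      Finset.sum_nonneg fun z _ => mul_nonneg (hQ.offDiagRate_nonneg x z)
        (Finset.sum_nonneg fun k _ => hQ.jumpDensity_nonneg k hr.1.le z y)
    rw [Real.norm_of_nonneg (mul_nonneg (Real.exp_nonneg _) h2)]
    refine mul_le_mul_of_nonneg_left (Finset.sum_le_sum fun z _ => ?_) (Real.exp_nonneg _)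
    exact mul_le_of_le_one_right (hQ.offDiagRate_nonneg x z)
      (hQ.sum_jumpDensity_le_one K hr.1.le z y)
  · rw [uIoc_of_le ht] at hr
    rw [backwardIntegrand, max_eq_left hr.1.le]
    exact (tendsto_finsetSum _ fun z _ =>
      (hQ.hasSum_jumpDensity hr.1.le z y).tendsto_sum_nat.const_mul _).const_mul _

theorem continuous_transitionDensity_max (hQ : IsRateMatrix Q N) (x y : I) :
    Continuous fun t => transitionDensity Q (max t 0) x y := by
  have h : ∀ t : ℝ, transitionDensity Q (max t 0) x y = Real.exp (Q x x * max t 0) *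
      ((if x = y then 1 else 0) + ∫ r in (0 : ℝ)..(max t 0), backwardIntegrand Q N x y r) :=
    fun t => hQ.transitionDensity_eq_integral (le_max_right t 0) x y
  simp only [h]
  have h2 : Continuous fun t : ℝ => ∫ r in (0 : ℝ)..(max t 0), backwardIntegrand Q N x y r :=
    (intervalIntegral.continuous_primitive
      (hQ.intervalIntegrable_backwardIntegrand x y) 0).comp (continuous_id.max continuous_const)
  fun_prop

theorem continuousOn_transitionDensity (hQ : IsRateMatrix Q N) (x y : I) :
    ContinuousOn (fun t => transitionDensity Q t x y) (Ici 0) := by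
  refine (hQ.continuous_transitionDensity_max x y).continuousOn.congr fun t ht => ?_
  simp only [max_eq_left (mem_Ici.1 ht)]

/-- Kolmogorov's backward equation. -/
theorem hasDerivAt_transitionDensity (hQ : IsRateMatrix Q N) {t : ℝ} (ht : 0 < t) (x y : I) :
    HasDerivAt (fun t => transitionDensity Q t x y)
      (∑ z ∈ N x, Q x z * transitionDensity Q t z y) t := by
  have hcont : Continuous (backwardIntegrand Q N x y) := by
    have := fun z => hQ.continuous_transitionDensity_max z y
    unfold backwardIntegrand
    fun_prop
  have h1 : HasDerivAt (fun t => Real.exp (Q x x * t)) (Real.exp (Q x x * t) * (Q x x)) t := by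
    simpa using ((hasDerivAt_id t).const_mul (Q x x)).exp
  have h2 := (hcont.integral_hasStrictDerivAt 0 t).hasDerivAt.const_add
    (if x = y then (1 : ℝ) else 0)
  have h3 := h1.mul h2
  have heq : (fun t => transitionDensity Q t x y) =ᶠ[𝓝 t] fun t => Real.exp (Q x x * t) *
      ((if x = y then 1 else 0) + ∫ r in (0 : ℝ)..t, backwardIntegrand Q N x y r) := by
    filter_upwards [Ioi_mem_nhds ht] with s hs
    exact hQ.transitionDensity_eq_integral (le_of_lt hs) x y
  refine (h3.congr_of_eventuallyEq heq).congr_deriv ?_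
  rw [hQ.sum_eq_diag_add, hQ.transitionDensity_eq_integral ht.le x y, backwardIntegrand,
    max_eq_left ht.le, ← mul_assoc, ← Real.exp_add, add_neg_cancel, Real.exp_zero, one_mul]
  ring

end IsRateMatrix

/-! ### Truncation to finite sets of states -/

/-- The transition density of the chain killed when it leaves the finite set `J`: the exponential of
the matrix of rates restricted to `J`, extended by `0`. -/
noncomputable def truncatedDensity {I : Type} [DecidableEq I] (Q : I → I → ℝ) (J : Finset I) (t : ℝ)
    (x y : I) : ℝ :=
  if h : x ∈ J ∧ y ∈ J then
    NormedSpace.exp (t • Matrix.of fun a b : J => Q a b) ⟨x, h.1⟩ ⟨y, h.2⟩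
  else 0

section Truncated

variable {I : Type} [DecidableEq I] {Q : I → I → ℝ} {N : I → Finset I} {J : Finset I}

theorem truncatedDensity_apply (Q : I → I → ℝ) (t : ℝ) (a b : J) :
    truncatedDensity Q J t a b = NormedSpace.exp (t • Matrix.of fun a b : J => Q a b) a b := by
  rw [truncatedDensity, dif_pos ⟨a.2, b.2⟩]

theorem truncatedDensity_eq_zero_left {t : ℝ} {x : I} (hx : x ∉ J) (y : I) :
    truncatedDensity Q J t x y = 0 := by
  rw [truncatedDensity, dif_neg fun h => hx h.1]

theorem truncatedDensity_eq_zero_right {t : ℝ} (x : I) {y : I} (hy : y ∉ J) :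
    truncatedDensity Q J t x y = 0 := by
  rw [truncatedDensity, dif_neg fun h => hy h.2]

theorem truncatedDensity_zero {x y : I} (hx : x ∈ J) :
    truncatedDensity Q J 0 x y = if x = y then 1 else 0 := by
  by_cases hy : y ∈ J
  · rw [truncatedDensity, dif_pos ⟨hx, hy⟩, zero_smul, NormedSpace.exp_zero, Matrix.one_apply]
    simp
  · rw [truncatedDensity_eq_zero_right x hy, if_neg]
    rintro rfl
    exact hy hx

theorem hasDerivAt_truncatedDensity_backward (Q : I → I → ℝ) (t : ℝ) {x : I} (hx : x ∈ J) (y : I) :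
    HasDerivAt (fun t => truncatedDensity Q J t x y)
      (∑ z ∈ J, Q x z * truncatedDensity Q J t z y) t := by
  by_cases hy : y ∈ J
  · let _ : NormedRing (Matrix J J ℝ) := Matrix.linftyOpNormedRing
    let _ : NormedAlgebra ℝ (Matrix J J ℝ) := Matrix.linftyOpNormedAlgebra
    have h := hasDerivAt_exp_smul_const' (𝕂 := ℝ) (Matrix.of fun a b : J => Q a b) t
    have h2 := ((Matrix.entryLinearMap ℝ ℝ (⟨x, hx⟩ : J)
      (⟨y, hy⟩ : J)).toContinuousLinearMap.hasFDerivAt).comp_hasDerivAt t h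
    have hx' : ∀ s, truncatedDensity Q J s x y =
      NormedSpace.exp (s • Matrix.of fun a b : J => Q a b) ⟨x, hx⟩ ⟨y, hy⟩ :=
      fun s => truncatedDensity_apply Q s ⟨x, hx⟩ ⟨y, hy⟩
    refine (h2.congr_of_eventuallyEq (Eventually.of_forall hx')).congr_deriv ?_
    change (Matrix.of (fun a b : J => Q a b) *
      NormedSpace.exp (t • Matrix.of fun a b : J => Q a b)) ⟨x, hx⟩ ⟨y, hy⟩ = _
    rw [Matrix.mul_apply, ← Finset.sum_coe_sort J]
    exact Finset.sum_congr rfl fun z _ => by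
      rw [truncatedDensity_apply Q t z ⟨y, hy⟩]
      rfl
  · simp only [truncatedDensity_eq_zero_right _ hy, mul_zero, Finset.sum_const_zero]
    exact hasDerivAt_const t 0

theorem hasDerivAt_truncatedDensity_forward (Q : I → I → ℝ) (t : ℝ) (x : I) {y : I} (hy : y ∈ J) :
    HasDerivAt (fun t => truncatedDensity Q J t x y)
      (∑ z ∈ J, truncatedDensity Q J t x z * Q z y) t := by
  by_cases hx : x ∈ J
  · let _ : NormedRing (Matrix J J ℝ) := Matrix.linftyOpNormedRing
    let _ : NormedAlgebra ℝ (Matrix J J ℝ) := Matrix.linftyOpNormedAlgebra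
    have h := hasDerivAt_exp_smul_const (𝕂 := ℝ) (Matrix.of fun a b : J => Q a b) t
    have h2 := ((Matrix.entryLinearMap ℝ ℝ (⟨x, hx⟩ : J)
      (⟨y, hy⟩ : J)).toContinuousLinearMap.hasFDerivAt).comp_hasDerivAt t h
    have hx' : ∀ s, truncatedDensity Q J s x y =
      NormedSpace.exp (s • Matrix.of fun a b : J => Q a b) ⟨x, hx⟩ ⟨y, hy⟩ :=
      fun s => truncatedDensity_apply Q s ⟨x, hx⟩ ⟨y, hy⟩
    refine (h2.congr_of_eventuallyEq (Eventually.of_forall hx')).congr_deriv ?_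
    change (NormedSpace.exp (t • Matrix.of fun a b : J => Q a b) *
      Matrix.of (fun a b : J => Q a b)) ⟨x, hx⟩ ⟨y, hy⟩ = _
    rw [Matrix.mul_apply, ← Finset.sum_coe_sort J]
    exact Finset.sum_congr rfl fun z _ => by
      rw [truncatedDensity_apply Q t ⟨x, hx⟩ z]
      rfl
  · simp only [truncatedDensity_eq_zero_left hx, zero_mul, Finset.sum_const_zero]
    exact hasDerivAt_const t 0

theorem hasDerivAt_truncatedDensity_ite (Q : I → I → ℝ) (J : Finset I) (t : ℝ) (x y : I) :
    HasDerivAt (fun t => truncatedDensity Q J t x y)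
      (if x ∈ J then ∑ z ∈ J, Q x z * truncatedDensity Q J t z y else 0) t := by
  split_ifs with hx
  · exact hasDerivAt_truncatedDensity_backward Q t hx y
  · simp only [truncatedDensity_eq_zero_left hx]
    exact hasDerivAt_const t 0

theorem continuous_truncatedDensity (Q : I → I → ℝ) (J : Finset I) (x y : I) :
    Continuous fun t => truncatedDensity Q J t x y :=
  continuous_iff_continuousAt.2 fun t => (hasDerivAt_truncatedDensity_ite Q J t x y).continuousAt

/-- Reversibility of the truncated chain: conjugation by the diagonal matrix of `m` transposes the
matrix of rates, hence its exponential. -/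
theorem truncatedDensity_reversible {m : I → ℝ} (hm : ∀ x, 0 < m x)
    (hrev : ∀ x y, m x * Q x y = m y * Q y x) (t : ℝ) (x y : I) :
    m x * truncatedDensity Q J t x y = m y * truncatedDensity Q J t y x := by
  by_cases h : x ∈ J ∧ y ∈ J
  swap
  · rcases not_and_or.1 h with h | h
    · rw [truncatedDensity_eq_zero_left h, truncatedDensity_eq_zero_right _ h, mul_zero, mul_zero]
    · rw [truncatedDensity_eq_zero_left h, truncatedDensity_eq_zero_right _ h, mul_zero, mul_zero]
  obtain ⟨a, rfl⟩ : ∃ a : J, (a : I) = x := ⟨⟨x, h.1⟩, rfl⟩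
  obtain ⟨b, rfl⟩ : ∃ b : J, (b : I) = y := ⟨⟨y, h.2⟩, rfl⟩
  rw [truncatedDensity_apply, truncatedDensity_apply]
  set A : Matrix J J ℝ := t • Matrix.of fun a b : J => Q a b with hA
  set D : Matrix J J ℝ := Matrix.diagonal fun a : J => m a with hD
  have hDu : IsUnit D := by
    rw [hD, Matrix.isUnit_diagonal, Pi.isUnit_iff]
    exact fun a => (hm a).ne'.isUnit
  have hdet : IsUnit D.det := (Matrix.isUnit_iff_isUnit_det D).1 hDu
  have hDA : D * A = A.transpose * D := by
    ext i j
    rw [hD, Matrix.diagonal_mul, Matrix.mul_diagonal, hA]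
    simp only [Matrix.smul_apply, Matrix.transpose_apply, Matrix.of_apply, smul_eq_mul]
    linear_combination t * hrev i j
  have hconj : D * A * D⁻¹ = A.transpose := by
    rw [hDA, Matrix.mul_assoc, Matrix.mul_nonsing_inv _ hdet, Matrix.mul_one]
  have h1 := Matrix.exp_conj D A hDu
  rw [hconj, Matrix.exp_transpose] at h1
  have h2 : (NormedSpace.exp A).transpose * D = D * NormedSpace.exp A := by
    rw [h1, Matrix.mul_assoc, Matrix.nonsing_inv_mul _ hdet, Matrix.mul_one]
  have h3 := congrFun (congrFun h2 a) b
  rw [hD, Matrix.diagonal_mul, Matrix.mul_diagonal, Matrix.transpose_apply] at h3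
  linarith

end Truncated

namespace IsRateMatrix

variable {I : Type} [DecidableEq I] {Q : I → I → ℝ} {N : I → Finset I} {J : Finset I}

theorem sum_mul_eq_of_forall_notMem (hQ : IsRateMatrix Q N) (x : I) {a : I → ℝ}
    (ha : ∀ z, z ∉ J → a z = 0) : ∑ z ∈ J, Q x z * a z = ∑ z ∈ N x, Q x z * a z := by
  rw [Finset.sum_subset (Finset.subset_union_left (s₂ := N x)),
    Finset.sum_subset (Finset.subset_union_right (s₁ := J) (s₂ := N x))]
  · intro z _ hz
    rw [hQ.eq_zero x z hz, zero_mul]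
  · intro z _ hz
    rw [ha z hz, mul_zero]

theorem truncatedDensity_nonneg (hQ : IsRateMatrix Q N) {t : ℝ} (ht : 0 ≤ t) (x y : I) :
    0 ≤ truncatedDensity Q J t x y := by
  refine nonneg_of_deriv_nonneg_at_min (fun x t => truncatedDensity Q J t x y)
    (fun x t => if x ∈ J then ∑ z ∈ J, Q x z * truncatedDensity Q J t z y else 0)
    J.finite_toSet (fun v => (continuous_truncatedDensity Q J v y).continuousOn)
    (fun v t _ => hasDerivAt_truncatedDensity_ite Q J t v y) ?_ ?_ ?_ x t ht
  · intro v
    by_cases hv : v ∈ J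
    · simp only [truncatedDensity_zero hv]
      split_ifs <;> norm_num
    · exact (truncatedDensity_eq_zero_left hv y).ge
  · exact fun v hv s _ => (truncatedDensity_eq_zero_left (by simpa using hv) y).ge
  · intro v s _ hneg hmin
    split_ifs
    · rw [hQ.sum_mul_eq_of_forall_notMem v fun z hz => truncatedDensity_eq_zero_left hz y]
      exact hQ.sum_mul_nonneg_of_min (a := fun z => truncatedDensity Q J s z y) hneg.le
        fun z _ => hmin z
    · exact le_rfl

theorem sum_truncatedDensity_le_one (hQ : IsRateMatrix Q N) {t : ℝ} (ht : 0 ≤ t) (x : I) :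
    ∑ y ∈ J, truncatedDensity Q J t x y ≤ 1 := by
  rw [← sub_nonneg]
  refine nonneg_of_deriv_nonneg_at_min (fun x t => 1 - ∑ y ∈ J, truncatedDensity Q J t x y)
    (fun x t => -∑ y ∈ J, if x ∈ J then ∑ z ∈ J, Q x z * truncatedDensity Q J t z y else 0)
    J.finite_toSet (fun v => Continuous.continuousOn ?_) ?_ ?_ ?_ ?_ x t ht
  · have := continuous_truncatedDensity Q J v
    fun_prop
  · exact fun v s _ => (HasDerivAt.fun_sum fun y _ =>
      hasDerivAt_truncatedDensity_ite Q J s v y).const_sub 1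
  · intro v
    by_cases hv : v ∈ J
    · simp [truncatedDensity_zero hv, hv]
    · simp [truncatedDensity_eq_zero_left hv]
  · intro v hv s _
    simp [truncatedDensity_eq_zero_left (by simpa using hv : v ∉ J)]
  · intro v s _ hneg hmin
    by_cases hv : v ∈ J
    · simp only [hv, if_true]
      have h1 := hQ.sum_mul_nonneg_of_min (x := v)
        (a := fun z => 1 - ∑ y ∈ J, truncatedDensity Q J s z y) hneg.le fun z _ => hmin z
      have h2 : ∑ z ∈ N v, Q v z * (1 - ∑ y ∈ J, truncatedDensity Q J s z y) =
          ∑ z ∈ N v, Q v z - ∑ y ∈ J, ∑ z ∈ J, Q v z * truncatedDensity Q J s z y := by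
        simp only [mul_sub, mul_one, Finset.sum_sub_distrib]
        rw [Finset.sum_comm, ← hQ.sum_mul_eq_of_forall_notMem (J := J) v]
        · simp only [Finset.mul_sum]
        · exact fun z hz => Finset.sum_eq_zero fun y _ => truncatedDensity_eq_zero_left hz y
      linarith [hQ.row_sum_nonpos v]
    · simp [hv]

theorem truncatedDensity_le_one (hQ : IsRateMatrix Q N) {t : ℝ} (ht : 0 ≤ t) (x y : I) :
    truncatedDensity Q J t x y ≤ 1 := by
  by_cases hy : y ∈ J
  · exact (Finset.single_le_sum (f := fun y => truncatedDensity Q J t x y)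
      (fun y _ => hQ.truncatedDensity_nonneg ht x y) hy).trans
      (hQ.sum_truncatedDensity_le_one ht x)
  · rw [truncatedDensity_eq_zero_right x hy]
    exact zero_le_one

end IsRateMatrix

namespace IsLyapunov

variable {I : Type} [DecidableEq I] {Q : I → I → ℝ} {N : I → Finset I} {f : I → ℝ}

theorem truncatedDensity_le (hf : IsLyapunov Q N f) (hQ : IsRateMatrix Q N) (J : Finset I) {t : ℝ}
    (ht : 0 ≤ t) (x y : I) : truncatedDensity Q J t x y ≤ transitionDensity Q t x y := by
  have h := hf.le_of_subsolution hQ (C := 1) le_rfl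
    (u := fun x t => truncatedDensity Q J t x y - transitionDensity Q t x y)
    (u' := fun x t => (if x ∈ J then ∑ z ∈ J, Q x z * truncatedDensity Q J t z y else 0) -
      ∑ z ∈ N x, Q x z * transitionDensity Q t z y)
    (fun x => (continuous_truncatedDensity Q J x y).continuousOn.sub
      (hQ.continuousOn_transitionDensity x y))
    (fun x t ht => (hasDerivAt_truncatedDensity_ite Q J t x y).sub
      (hQ.hasDerivAt_transitionDensity ht x y))
    (fun x t ht => by
      linarith [hQ.truncatedDensity_le_one ht x y (J := J), hQ.transitionDensity_nonneg ht x y])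
    (fun x t ht => ?_) (fun x => ?_) ht x
  · simp only [zero_mul] at h
    linarith
  · simp only [mul_sub, Finset.sum_sub_distrib]
    refine sub_le_sub_right ?_ _
    split_ifs with hx
    · rw [hQ.sum_mul_eq_of_forall_notMem x fun z hz => truncatedDensity_eq_zero_left hz y]
    · refine Finset.sum_nonneg fun z _ => ?_
      rcases eq_or_ne z x with rfl | hzx
      · rw [truncatedDensity_eq_zero_left hx, mul_zero]
      · exact mul_nonneg (hQ.offdiag_nonneg x z hzx) (hQ.truncatedDensity_nonneg ht.le z y)
  · rw [transitionDensity_zero, zero_mul, sub_nonpos]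
    by_cases hx : x ∈ J
    · rw [truncatedDensity_zero hx]
    · rw [truncatedDensity_eq_zero_left hx]
      split_ifs <;> norm_num

theorem transitionDensity_le_truncatedDensity_add (hf : IsLyapunov Q N f) (hQ : IsRateMatrix Q N)
    {J : Finset I} {ε : ℝ} (hε : 0 ≤ ε) (hJ : ∀ x, x ∉ J → 1 ≤ ε * f x) {t : ℝ} (ht : 0 ≤ t)
    (x y : I) :
    transitionDensity Q t x y ≤ truncatedDensity Q J t x y + ε * Real.exp t * f x := by
  have h := nonneg_of_deriv_nonneg_at_min
    (fun x t => ε * Real.exp t * f x - transitionDensity Q t x y + truncatedDensity Q J t x y)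
    (fun x t => ε * Real.exp t * f x - ∑ z ∈ N x, Q x z * transitionDensity Q t z y +
      (if x ∈ J then ∑ z ∈ J, Q x z * truncatedDensity Q J t z y else 0))
    J.finite_toSet
    (fun v => ((Continuous.continuousOn (by fun_prop)).sub
      (hQ.continuousOn_transitionDensity v y)).add
        (continuous_truncatedDensity Q J v y).continuousOn)
    (fun v s hs => ((((Real.hasDerivAt_exp s).const_mul _).mul_const _).sub
      (hQ.hasDerivAt_transitionDensity hs v y)).add
        (hasDerivAt_truncatedDensity_ite Q J s v y)) ?_ ?_ ?_ x t ht
  · linarith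
  · intro v
    have hfv := mul_nonneg hε (hf.nonneg v)
    simp only [Real.exp_zero, mul_one, transitionDensity_zero]
    by_cases hv : v ∈ J
    · rw [truncatedDensity_zero hv]
      linarith
    · rw [truncatedDensity_eq_zero_left hv]
      have := hJ v hv
      split_ifs <;> linarith
  · intro v hv s hs
    have hv : v ∉ J := by simpa using hv
    have h1 := hJ v hv
    have h2 := hQ.transitionDensity_le_one hs v y
    have h3 : ε * f v ≤ ε * Real.exp s * f v := by
      nlinarith [Real.one_le_exp hs, mul_nonneg hε (hf.nonneg v)]
    simp only [truncatedDensity_eq_zero_left hv]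
    linarith
  · intro v s hs hneg hmin
    have hv : v ∈ J := by
      by_contra hv
      have h1 := hJ v hv
      have h2 := hQ.transitionDensity_le_one hs.le v y
      have h3 : ε * f v ≤ ε * Real.exp s * f v := by
        nlinarith [Real.one_le_exp hs.le, mul_nonneg hε (hf.nonneg v)]
      simp only [truncatedDensity_eq_zero_left hv] at hneg
      linarith
    have h1 := hQ.sum_mul_nonneg_of_min (x := v)
      (a := fun z => ε * Real.exp s * f z - transitionDensity Q s z y + truncatedDensity Q J s z y)
      hneg.le fun z _ => hmin z
    have h2 : ∑ z ∈ N v, Q v z * (ε * Real.exp s * f z - transitionDensity Q s z y +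
        truncatedDensity Q J s z y) = ε * Real.exp s * ∑ z ∈ N v, Q v z * f z -
        ∑ z ∈ N v, Q v z * transitionDensity Q s z y +
        ∑ z ∈ N v, Q v z * truncatedDensity Q J s z y := by
      rw [Finset.mul_sum, ← Finset.sum_sub_distrib, ← Finset.sum_add_distrib]
      exact Finset.sum_congr rfl fun z _ => by ring
    have h3 := mul_le_mul_of_nonneg_left (hf.drift v) (by positivity : 0 ≤ ε * Real.exp s)
    simp only [hv, if_true]
    rw [hQ.sum_mul_eq_of_forall_notMem v fun z hz => truncatedDensity_eq_zero_left hz y]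
    linarith

theorem tendsto_truncatedDensity (hf : IsLyapunov Q N f) (hQ : IsRateMatrix Q N) {t : ℝ}
    (ht : 0 ≤ t) (x y : I) :
    Tendsto (fun J : Finset I => truncatedDensity Q J t x y) atTop
      (𝓝 (transitionDensity Q t x y)) := by
  rw [Metric.tendsto_atTop]
  intro δ hδ
  have hc : 0 < Real.exp t * f x + 1 := by
    have := mul_nonneg (Real.exp_nonneg t) (hf.nonneg x)
    linarith
  obtain ⟨A, hA⟩ := hf.exists_finset (div_pos hδ hc)
  refine ⟨A, fun J hJ => ?_⟩
  have h1 := hf.truncatedDensity_le hQ J ht x y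
  have h2 := hf.transitionDensity_le_truncatedDensity_add hQ (div_pos hδ hc).le
    (fun z hz => hA z fun h => hz (hJ h)) ht x y
  have h3 : δ / (Real.exp t * f x + 1) * Real.exp t * f x < δ := by
    rw [mul_assoc, div_mul_eq_mul_div, div_lt_iff₀ hc]
    linarith
  rw [Real.dist_eq, abs_lt]
  constructor <;> linarith

theorem transitionDensity_reversible (hf : IsLyapunov Q N f) (hQ : IsRateMatrix Q N) {m : I → ℝ}
    (hm : ∀ x, 0 < m x) (hrev : ∀ x y, m x * Q x y = m y * Q y x) {t : ℝ} (ht : 0 ≤ t) (x y : I) :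
    m x * transitionDensity Q t x y = m y * transitionDensity Q t y x := by
  refine tendsto_nhds_unique ((hf.tendsto_truncatedDensity hQ ht x y).const_mul (m x)) ?_
  simp only [truncatedDensity_reversible hm hrev t x y]
  exact (hf.tendsto_truncatedDensity hQ ht y x).const_mul (m y)

theorem sum_transitionDensity_le_one (hf : IsLyapunov Q N f) (hQ : IsRateMatrix Q N) {t : ℝ}
    (ht : 0 ≤ t) (x : I) (A : Finset I) : ∑ y ∈ A, transitionDensity Q t x y ≤ 1 := by
  refine le_of_tendsto (tendsto_finsetSum A fun y _ => hf.tendsto_truncatedDensity hQ ht x y) ?_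
  filter_upwards [eventually_ge_atTop A] with J hJ
  exact (Finset.sum_le_sum_of_subset_of_nonneg hJ
    fun y _ _ => hQ.truncatedDensity_nonneg ht x y).trans (hQ.sum_truncatedDensity_le_one ht x)

theorem summable_transitionDensity (hf : IsLyapunov Q N f) (hQ : IsRateMatrix Q N) {t : ℝ}
    (ht : 0 ≤ t) (x : I) : Summable (transitionDensity Q t x) :=
  summable_of_sum_le (fun y => hQ.transitionDensity_nonneg ht x y)
    fun A => hf.sum_transitionDensity_le_one hQ ht x A

/-- A chain with a Lyapunov function and without killing does not lose mass: `1 - ∑_{y ∈ A} p_t(x, y)`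
solves the backward equation and starts below `ε f` when `ε f ≥ 1` off `A`. -/
theorem tsum_transitionDensity_eq_one (hf : IsLyapunov Q N f) (hQ : IsRateMatrix Q N)
    (hrow : ∀ x, ∑ z ∈ N x, Q x z = 0) {t : ℝ} (ht : 0 ≤ t) (x : I) :
    ∑' y, transitionDensity Q t x y = 1 := by
  refine le_antisymm ((hf.summable_transitionDensity hQ ht x).tsum_le_of_sum_le
    fun A => hf.sum_transitionDensity_le_one hQ ht x A) ?_
  have key : ∀ ε > 0, 1 - ∑' y, transitionDensity Q t x y ≤ ε * Real.exp t * f x := by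
    intro ε hε
    obtain ⟨A, hA⟩ := hf.exists_finset hε
    have h := hf.le_of_subsolution hQ (C := 1) hε.le
      (u := fun x t => 1 - ∑ y ∈ A, transitionDensity Q t x y)
      (u' := fun x t => -∑ y ∈ A, ∑ z ∈ N x, Q x z * transitionDensity Q t z y)
      (fun x => continuousOn_const.sub
        (continuousOn_finsetSum _ fun y _ => hQ.continuousOn_transitionDensity x y))
      (fun x t ht => (HasDerivAt.fun_sum fun y _ =>
        hQ.hasDerivAt_transitionDensity ht x y).const_sub 1)
      (fun x t ht => sub_le_self _ (Finset.sum_nonneg fun y _ =>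
        hQ.transitionDensity_nonneg ht x y))
      (fun x t ht => ?_) (fun x => ?_) ht x
    · have h2 := (hf.summable_transitionDensity hQ ht x).sum_le_tsum A
        fun y _ => hQ.transitionDensity_nonneg ht x y
      linarith
    · simp only [mul_sub, mul_one, Finset.sum_sub_distrib, hrow, zero_sub, Finset.mul_sum]
      rw [Finset.sum_comm]
    · simp only [transitionDensity_zero]
      by_cases hx : x ∈ A
      · simpa [hx] using mul_nonneg hε.le (hf.nonneg x)
      · simpa [hx] using hA x hx
  have hlim : Tendsto (fun ε : ℝ => ε * Real.exp t * f x) (𝓝[>] 0) (𝓝 (0 * Real.exp t * f x)) :=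
    (Continuous.tendsto (by fun_prop) 0).mono_left nhdsWithin_le_nhds
  have := ge_of_tendsto hlim (eventually_nhdsWithin_of_forall fun ε hε => key ε hε)
  simp only [zero_mul] at this
  linarith

end IsLyapunov

/-! ### Duality of transition densities -/

section Duality

variable {I : Type} [DecidableEq I] {Q Qd : I → I → ℝ} {N Nd : I → Finset I} {H : I → I → ℝ}
  {f g : I → ℝ}

/-- Half of the duality relation, with both sides truncated. As a function of `x`, the left-hand side
is a subsolution of the backward equation for `Q`, because truncation only loses mass. -/
theorem sum_truncatedDensity_mul_le (hQ : IsRateMatrix Q N) (hf : IsLyapunov Q N f)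
    (hQd : IsRateMatrix Qd Nd) (hH0 : ∀ x v, 0 ≤ H x v) (hH1 : ∀ x v, H x v ≤ 1)
    (hdual : ∀ x v, ∑ w ∈ Nd v, Qd v w * H x w = ∑ z ∈ N x, Q x z * H z v)
    (J A : Finset I) {ε : ℝ} (hε : 0 ≤ ε) (hA : ∀ x, x ∉ A → 1 ≤ ε * f x)
    {t : ℝ} (ht : 0 ≤ t) (x v : I) :
    ∑ w ∈ J, truncatedDensity Qd J t v w * H x w ≤
      ∑ z ∈ A, transitionDensity Q t x z * H z v + ε * Real.exp t * f x := by
  have hnn : ∀ x t, 0 ≤ t → 0 ≤ ∑ z ∈ A, transitionDensity Q t x z * H z v := fun x t ht =>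
    Finset.sum_nonneg fun z _ => mul_nonneg (hQ.transitionDensity_nonneg ht x z) (hH0 z v)
  have h := hf.le_of_subsolution hQ (C := 1) hε
    (u := fun x t => ∑ w ∈ J, truncatedDensity Qd J t v w * H x w -
      ∑ z ∈ A, transitionDensity Q t x z * H z v)
    (u' := fun x t => ∑ w ∈ J, (∑ c ∈ J, truncatedDensity Qd J t v c * Qd c w) * H x w -
      ∑ z ∈ A, (∑ b ∈ N x, Q x b * transitionDensity Q t b z) * H z v)
    (fun x => ?_) (fun x t ht => ?_) (fun x t ht => ?_) (fun x t ht => ?_) (fun x => ?_) ht x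
  · linarith
  · refine ContinuousOn.sub (Continuous.continuousOn ?_)
      (continuousOn_finsetSum _ fun z _ =>
        (hQ.continuousOn_transitionDensity x z).mul continuousOn_const)
    have := continuous_truncatedDensity Qd J v
    fun_prop
  · exact (HasDerivAt.fun_sum fun w hw =>
      (hasDerivAt_truncatedDensity_forward Qd t v hw).mul_const _).sub
      (HasDerivAt.fun_sum fun z _ => (hQ.hasDerivAt_transitionDensity ht x z).mul_const _)
  · have h1 : ∑ w ∈ J, truncatedDensity Qd J t v w * H x w ≤ ∑ w ∈ J, truncatedDensity Qd J t v w :=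
      Finset.sum_le_sum fun w _ =>
        mul_le_of_le_one_right (hQd.truncatedDensity_nonneg ht v w) (hH1 x w)
    have h2 := hQd.sum_truncatedDensity_le_one ht v (J := J)
    have h3 := hnn x t ht
    linarith
  · have hloss : ∀ c ∈ J, ∑ w ∈ J, Qd c w * H x w ≤ ∑ w ∈ Nd c, Qd c w * H x w := by
      intro c hc
      rw [Finset.sum_subset (Finset.subset_union_right (s₁ := J) (s₂ := Nd c))
        (fun w _ hw => by rw [hQd.eq_zero c w hw, zero_mul])]
      refine Finset.sum_le_sum_of_subset_of_nonneg Finset.subset_union_left fun w _ hw => ?_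
      exact mul_nonneg (hQd.offdiag_nonneg c w fun h => hw (h ▸ hc)) (hH0 x w)
    have h1 : ∑ w ∈ J, (∑ c ∈ J, truncatedDensity Qd J t v c * Qd c w) * H x w ≤
        ∑ z ∈ N x, Q x z * ∑ w ∈ J, truncatedDensity Qd J t v w * H z w := by
      calc ∑ w ∈ J, (∑ c ∈ J, truncatedDensity Qd J t v c * Qd c w) * H x w
          = ∑ c ∈ J, truncatedDensity Qd J t v c * ∑ w ∈ J, Qd c w * H x w := by
            simp only [Finset.sum_mul, Finset.mul_sum]
            rw [Finset.sum_comm]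
            simp only [mul_assoc]
        _ ≤ ∑ c ∈ J, truncatedDensity Qd J t v c * ∑ z ∈ N x, Q x z * H z c := by
            refine Finset.sum_le_sum fun c hc => ?_
            rw [← hdual]
            exact mul_le_mul_of_nonneg_left (hloss c hc) (hQd.truncatedDensity_nonneg ht.le v c)
        _ = _ := by
            simp only [Finset.mul_sum]
            rw [Finset.sum_comm]
            exact Finset.sum_congr rfl fun _ _ => Finset.sum_congr rfl fun _ _ => by ring
    have h2 : ∑ z ∈ A, (∑ b ∈ N x, Q x b * transitionDensity Q t b z) * H z v =
        ∑ b ∈ N x, Q x b * ∑ z ∈ A, transitionDensity Q t b z * H z v := by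
      simp only [Finset.sum_mul, Finset.mul_sum]
      rw [Finset.sum_comm]
      simp only [mul_assoc]
    simp only [mul_sub, Finset.sum_sub_distrib]
    linarith
  · have hJ : ∑ w ∈ J, truncatedDensity Qd J 0 v w * H x w ≤ H x v := by
      by_cases hv : v ∈ J
      · simp [truncatedDensity_zero hv, hv]
      · simpa [truncatedDensity_eq_zero_left hv] using hH0 x v
    simp only [transitionDensity_zero]
    by_cases hx : x ∈ A
    · simp only [ite_mul, one_mul, zero_mul, Finset.sum_ite_eq, hx, if_true]
      have := mul_nonneg hε (hf.nonneg x)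
      linarith
    · simp only [ite_mul, one_mul, zero_mul, Finset.sum_ite_eq, hx, if_false]
      have := hA x hx
      have := hH1 x v
      linarith

theorem summable_transitionDensity_mul (hQ : IsRateMatrix Q N) (hf : IsLyapunov Q N f) {h : I → ℝ}
    (h0 : ∀ x, 0 ≤ h x) (h1 : ∀ x, h x ≤ 1) {t : ℝ} (ht : 0 ≤ t) (x : I) :
    Summable fun z => transitionDensity Q t x z * h z :=
  (hf.summable_transitionDensity hQ ht x).of_nonneg_of_le
    (fun z => mul_nonneg (hQ.transitionDensity_nonneg ht x z) (h0 z))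
    fun z => mul_le_of_le_one_right (hQ.transitionDensity_nonneg ht x z) (h1 z)

theorem tsum_transitionDensity_mul_le (hQ : IsRateMatrix Q N) (hf : IsLyapunov Q N f)
    (hQd : IsRateMatrix Qd Nd) (hg : IsLyapunov Qd Nd g)
    (hH0 : ∀ x v, 0 ≤ H x v) (hH1 : ∀ x v, H x v ≤ 1)
    (hdual : ∀ x v, ∑ w ∈ Nd v, Qd v w * H x w = ∑ z ∈ N x, Q x z * H z v)
    {t : ℝ} (ht : 0 ≤ t) (x v : I) :
    ∑' w, transitionDensity Qd t v w * H x w ≤ ∑' z, transitionDensity Q t x z * H z v := by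
  have hJ : ∀ J : Finset I, ∑ w ∈ J, truncatedDensity Qd J t v w * H x w ≤
      ∑' z, transitionDensity Q t x z * H z v := by
    intro J
    have key : ∀ ε > 0, ∑ w ∈ J, truncatedDensity Qd J t v w * H x w ≤
        ∑' z, transitionDensity Q t x z * H z v + ε * Real.exp t * f x := by
      intro ε hε
      obtain ⟨A, hA⟩ := hf.exists_finset hε
      refine (sum_truncatedDensity_mul_le hQ hf hQd hH0 hH1 hdual J A hε.le hA ht x v).trans
        (add_le_add_left ?_ _)
      exact (summable_transitionDensity_mul hQ hf (fun z => hH0 z v) (fun z => hH1 z v) ht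
        x).sum_le_tsum A fun z _ => mul_nonneg (hQ.transitionDensity_nonneg ht x z) (hH0 z v)
    have hlim : Tendsto (fun ε : ℝ => ∑' z, transitionDensity Q t x z * H z v +
        ε * Real.exp t * f x) (𝓝[>] 0)
        (𝓝 (∑' z, transitionDensity Q t x z * H z v + 0 * Real.exp t * f x)) :=
      (Continuous.tendsto (by fun_prop) 0).mono_left nhdsWithin_le_nhds
    have := ge_of_tendsto hlim (eventually_nhdsWithin_of_forall fun ε hε => key ε hε)
    simpa using this
  refine (summable_transitionDensity_mul hQd hg (hH0 x) (hH1 x) ht v).tsum_le_of_sum_le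
    fun B => ?_
  refine le_of_tendsto (tendsto_finsetSum B fun w _ =>
    (hg.tendsto_truncatedDensity hQd ht v w).mul_const (H x w)) ?_
  filter_upwards [eventually_ge_atTop B] with J hBJ
  exact (Finset.sum_le_sum_of_subset_of_nonneg hBJ fun w _ _ =>
    mul_nonneg (hQd.truncatedDensity_nonneg ht v w) (hH0 x w)).trans (hJ J)

/-- Duality of nonexplosive chains: if their rate matrices are dual with respect to a function `H`
with values in `[0, 1]`, then so are their transition densities. -/
theorem tsum_transitionDensity_mul_eq (hQ : IsRateMatrix Q N) (hf : IsLyapunov Q N f)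
    (hQd : IsRateMatrix Qd Nd) (hg : IsLyapunov Qd Nd g)
    (hH0 : ∀ x v, 0 ≤ H x v) (hH1 : ∀ x v, H x v ≤ 1)
    (hdual : ∀ x v, ∑ w ∈ Nd v, Qd v w * H x w = ∑ z ∈ N x, Q x z * H z v)
    {t : ℝ} (ht : 0 ≤ t) (x v : I) :
    ∑' w, transitionDensity Qd t v w * H x w = ∑' z, transitionDensity Q t x z * H z v :=
  le_antisymm (tsum_transitionDensity_mul_le hQ hf hQd hg hH0 hH1 hdual ht x v)
    (tsum_transitionDensity_mul_le (H := fun a b => H b a) hQd hg hQ hf (fun a b => hH0 b a)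
      (fun a b => hH1 b a) (fun a b => (hdual b a).symm) ht v x)

end Duality

/-! ### Positivity and mass of Karlin–McGregor determinants -/

theorem HasDerivAt.matrix_det {n : ℕ} {A : ℝ → Matrix (Fin n) (Fin n) ℝ}
    {A' : Matrix (Fin n) (Fin n) ℝ} {t : ℝ}
    (h : ∀ i j, HasDerivAt (fun s => A s i j) (A' i j) t) :
    HasDerivAt (fun s => (A s).det) (∑ i, ((A t).updateRow i (A' i)).det) t := by
  have hdet : ∀ M : Matrix (Fin n) (Fin n) ℝ,
      M.det = ∑ σ : Equiv.Perm (Fin n), ((Equiv.Perm.sign σ : ℤ) : ℝ) * ∏ i, M i (σ i) := by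
    intro M
    rw [← Matrix.det_transpose, Matrix.det_apply']
    simp only [Matrix.transpose_apply]
  simp only [hdet]
  rw [Finset.sum_comm]
  refine HasDerivAt.fun_sum fun σ _ => ?_
  rw [← Finset.mul_sum]
  refine HasDerivAt.const_mul _ ?_
  refine (HasDerivAt.fun_finsetProd fun i _ => h i (σ i)).congr_deriv ?_
  refine Finset.sum_congr rfl fun k _ => ?_
  rw [← Finset.mul_prod_erase Finset.univ _ (Finset.mem_univ k), smul_eq_mul, mul_comm]
  congr 1
  · simp
  · refine Finset.prod_congr rfl fun j hj => ?_
    rw [Matrix.updateRow_ne (Finset.ne_of_mem_erase hj)]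

theorem Matrix.det_updateRow_sum_smul {n : ℕ} {I : Type} (M : Matrix (Fin n) (Fin n) ℝ) (i : Fin n)
    (s : Finset I) (c : I → ℝ) (r : I → Fin n → ℝ) :
    (M.updateRow i (fun j => ∑ z ∈ s, c z * r z j)).det =
      ∑ z ∈ s, c z * (M.updateRow i (r z)).det := by
  classical
  induction s using Finset.induction_on with
  | empty => exact Matrix.det_eq_zero_of_row_eq_zero i fun j => by simp
  | insert a s ha ih =>
    have hrow : (fun j => ∑ z ∈ insert a s, c z * r z j) =
        c a • r a + fun j => ∑ z ∈ s, c z * r z j := by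
      ext j
      simp [Finset.sum_insert ha]
    rw [hrow, Matrix.det_updateRow_add, Matrix.det_updateRow_smul, ih, Finset.sum_insert ha]

/-- The matrix with entries `1(x_i = y_j)` for increasing `x` and `y`: unless `x = y`, some `x_i` is
not among the `y_j`, and the matrix has a zero row. -/
theorem det_of_eq_strictMono {I : Type} [LinearOrder I] {n : ℕ} {x y : Fin n → I}
    (hx : StrictMono x) (hy : StrictMono y) :
    (Matrix.of fun i j : Fin n => if x i = y j then (1 : ℝ) else 0).det =
      if x = y then 1 else 0 := by
  split_ifs with h
  · subst h
    simp only [hx.injective.eq_iff]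
    exact Matrix.det_one
  · obtain ⟨i, hi⟩ : ∃ i, ∀ j, x i ≠ y j := by
      by_contra! hall
      refine h (hx.range_inj hy |>.1 ?_)
      refine Set.eq_of_subset_of_ncard_le ?_ ?_
      · rintro _ ⟨i, rfl⟩
        obtain ⟨j, hj⟩ := hall i
        exact ⟨j, hj.symm⟩
      · rw [← Set.image_univ, ← Set.image_univ, Set.ncard_image_of_injective _ hx.injective,
          Set.ncard_image_of_injective _ hy.injective]
    exact Matrix.det_eq_zero_of_row_eq_zero i fun j => by simp [hi j]

theorem IsLyapunov.sum_drift_le {I : Type} {Q : I → I → ℝ} {N : I → Finset I} {f : I → ℝ} {n : ℕ}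
    (hf : IsLyapunov Q N f) (hQ : IsRateMatrix Q N) (x : Fin n → I) :
    ∑ i, ∑ z ∈ N (x i), Q (x i) z * ∑ j, f (Function.update x i z j) ≤ ∑ i, f (x i) := by
  refine Finset.sum_le_sum fun i _ => ?_
  have hsum : ∀ z, ∑ j, f (Function.update x i z j) =
      f z + ∑ j ∈ Finset.univ.erase i, f (x j) := by
    intro z
    rw [← Finset.add_sum_erase Finset.univ _ (Finset.mem_univ i), Function.update_self]
    congr 1
    exact Finset.sum_congr rfl fun j hj => by
      rw [Function.update_of_ne (Finset.ne_of_mem_erase hj)]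
  simp only [hsum, mul_add, Finset.sum_add_distrib, ← Finset.sum_mul]
  have h1 := mul_nonpos_of_nonpos_of_nonneg (hQ.row_sum_nonpos (x i))
    (Finset.sum_nonneg fun j (_ : j ∈ Finset.univ.erase i) => hf.nonneg (x j))
  linarith [hf.drift (x i)]

section KarlinMcGregor

variable {I : Type} [LinearOrder I] {Q : I → I → ℝ} {N : I → Finset I} {f : I → ℝ} {n : ℕ}

theorem strictMono_or_not_injective_update (hN : ∀ x y z, z ∈ N x → (x < y → z ≤ y) ∧ (y < x → y ≤ z))
    {x : Fin n → I} (hx : StrictMono x) {i : Fin n} {z : I} (hz : z ∈ N (x i)) :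
    StrictMono (Function.update x i z) ∨ ¬ Function.Injective (Function.update x i z) := by
  by_cases hinj : Function.Injective (Function.update x i z)
  · refine Or.inl (Monotone.strictMono_of_injective (fun a b hab => ?_) hinj)
    rcases hab.eq_or_lt with rfl | hab
    · exact le_rfl
    · rcases eq_or_ne a i with rfl | ha
      · rw [Function.update_self, Function.update_of_ne hab.ne']
        exact (hN _ _ z hz).1 (hx hab)
      · rw [Function.update_of_ne ha]
        rcases eq_or_ne b i with rfl | hb
        · rw [Function.update_self]
          exact (hN _ _ z hz).2 (hx hab)
        · rw [Function.update_of_ne hb]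
          exact (hx hab).le
  · exact Or.inr hinj

/-- Minimum principle in the Weyl chamber for `n` independent chains that jump to neighbours only: a
supersolution of the backward equation of the `n` chains that is nonnegative at time `0` and at the
points with two equal coordinates, through which the chamber is left, is nonnegative in the
chamber. -/
theorem nonneg_of_supersolution_chamber (hQ : IsRateMatrix Q N) (hf : IsLyapunov Q N f)
    (hN : ∀ x y z, z ∈ N x → (x < y → z ≤ y) ∧ (y < x → y ≤ z))
    {u u' : (Fin n → I) → ℝ → ℝ} {C : ℝ}
    (hcont : ∀ x, ContinuousOn (u x) (Ici 0))
    (hderiv : ∀ x t, 0 < t → HasDerivAt (u x) (u' x t) t)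
    (hbound : ∀ x t, 0 ≤ t → -C ≤ u x t)
    (hsuper : ∀ x t, 0 < t →
      ∑ i, ∑ z ∈ N (x i), Q (x i) z * u (Function.update x i z) t ≤ u' x t)
    (hinit : ∀ x, StrictMono x → 0 ≤ u x 0)
    (hbdry : ∀ x, ¬ Function.Injective x → ∀ t, 0 ≤ t → 0 ≤ u x t)
    {x : Fin n → I} (hx : StrictMono x) {t : ℝ} (ht : 0 ≤ t) : 0 ≤ u x t := by
  set F : (Fin n → I) → ℝ := fun x => ∑ i, f (x i) with hF
  have hF0 : ∀ x, 0 ≤ F x := fun x => Finset.sum_nonneg fun i _ => hf.nonneg _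
  have key : ∀ δ > 0, 0 ≤ u x t + δ * Real.exp t * F x := by
    intro δ hδ
    have hK : {v : {x : Fin n → I // StrictMono x} | F v ≤ C / δ}.Finite := by
      have h1 : {y : Fin n → I | F y ≤ C / δ}.Finite := by
        refine (Set.Finite.pi' fun _ : Fin n => hf.finite_le (C / δ)).subset fun y hy i => ?_
        exact (Finset.single_le_sum (f := fun i => f (y i)) (fun i _ => hf.nonneg _)
          (Finset.mem_univ i)).trans hy
      exact h1.preimage Subtype.val_injective.injOn
    refine nonneg_of_deriv_nonneg_at_min (V := {x : Fin n → I // StrictMono x})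
      (fun v s => u v s + δ * Real.exp s * F v) (fun v s => u' v s + δ * Real.exp s * F v)
      hK ?_ ?_ ?_ ?_ ?_ ⟨x, hx⟩ t ht
    · exact fun v => (hcont v).add (Continuous.continuousOn (by fun_prop))
    · exact fun v s hs => (hderiv v s hs).add (((Real.hasDerivAt_exp s).const_mul _).mul_const _)
    · intro v
      have h1 := hinit v v.2
      have h2 := mul_nonneg hδ.le (hF0 v)
      simp only [Real.exp_zero, mul_one]
      linarith
    · intro v hv s hs
      simp only [mem_ofPred_eq, not_le, div_lt_iff₀ hδ] at hv
      have h1 := hbound v s hs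
      have h2 : δ * F v ≤ δ * Real.exp s * F v := by
        nlinarith [Real.one_le_exp hs, mul_nonneg hδ.le (hF0 v)]
      linarith
    · intro v s hs hneg hmin
      have h1 : 0 ≤ ∑ i, ∑ z ∈ N (v.1 i), Q (v.1 i) z * (u (Function.update v.1 i z) s +
          δ * Real.exp s * F (Function.update v.1 i z)) := by
        refine Finset.sum_nonneg fun i _ => ?_
        refine hQ.sum_mul_nonneg_of_min (x := v.1 i) (a := fun z => u (Function.update v.1 i z) s +
          δ * Real.exp s * F (Function.update v.1 i z)) ?_ fun z hz => ?_
        · simp only [Function.update_eq_self]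
          exact hneg.le
        · simp only [Function.update_eq_self]
          rcases strictMono_or_not_injective_update hN v.2 hz with h | h
          · exact hmin ⟨_, h⟩
          · have h2 := hbdry _ h s hs.le
            have h3 := mul_nonneg (mul_nonneg hδ.le (Real.exp_nonneg s))
              (hF0 (Function.update v.1 i z))
            linarith
      have h2 : ∑ i, ∑ z ∈ N (v.1 i), Q (v.1 i) z * (u (Function.update v.1 i z) s +
          δ * Real.exp s * F (Function.update v.1 i z)) =
          ∑ i, ∑ z ∈ N (v.1 i), Q (v.1 i) z * u (Function.update v.1 i z) s +
          δ * Real.exp s * ∑ i, ∑ z ∈ N (v.1 i), Q (v.1 i) z * F (Function.update v.1 i z) := by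
        simp only [mul_add, Finset.sum_add_distrib, Finset.mul_sum]
        congr 1
        exact Finset.sum_congr rfl fun _ _ => Finset.sum_congr rfl fun _ _ => by ring
      have h3 := mul_le_mul_of_nonneg_left (hf.sum_drift_le hQ v.1)
        (by positivity : 0 ≤ δ * Real.exp s)
      have h4 := hsuper v s hs
      linarith
  have hlim : Tendsto (fun δ : ℝ => u x t + δ * Real.exp t * F x) (𝓝[>] 0)
      (𝓝 (u x t + 0 * Real.exp t * F x)) :=
    (Continuous.tendsto (by fun_prop) 0).mono_left nhdsWithin_le_nhds
  have := ge_of_tendsto hlim (eventually_nhdsWithin_of_forall fun δ hδ => key δ hδ)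
  simpa using this

/-- The Karlin–McGregor determinant at arbitrary tuples of points. -/
noncomputable def transitionDet (Q : I → I → ℝ) (y x : Fin n → I) (t : ℝ) : ℝ :=
  (Matrix.of fun i j : Fin n => transitionDensity Q t (x i) (y j)).det

theorem transitionDet_eq_zero {x : Fin n → I} (hx : ¬ Function.Injective x) (y : Fin n → I) (t : ℝ) :
    transitionDet Q y x t = 0 := by
  simp only [Function.Injective, not_forall] at hx
  obtain ⟨i, j, hij, hne⟩ := hx
  exact Matrix.det_zero_of_row_eq hne (by ext k; simp [hij])

theorem transitionDet_zero {x y : Fin n → I} (hx : StrictMono x) (hy : StrictMono y) :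
    transitionDet Q y x 0 = if x = y then 1 else 0 := by
  simp only [transitionDet, transitionDensity_zero]
  exact det_of_eq_strictMono hx hy

theorem IsRateMatrix.continuousOn_transitionDet (hQ : IsRateMatrix Q N) (x y : Fin n → I) :
    ContinuousOn (transitionDet Q y x) (Ici 0) := by
  refine (Continuous.matrix_det continuous_id).comp_continuousOn ?_
  exact continuousOn_pi.2 fun i => continuousOn_pi.2 fun j =>
    hQ.continuousOn_transitionDensity (x i) (y j)

theorem IsRateMatrix.abs_transitionDet_le (hQ : IsRateMatrix Q N) (x y : Fin n → I) {t : ℝ}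
    (ht : 0 ≤ t) : |transitionDet Q y x t| ≤ n.factorial := by
  have h := Matrix.det_le (R := ℝ) (n := Fin n) (abv := IsAbsoluteValue.toAbsoluteValue abs)
    (A := Matrix.of fun i j : Fin n => transitionDensity Q t (x i) (y j)) (x := 1) fun i j => by
      have h0 := hQ.transitionDensity_nonneg ht (x i) (y j)
      have h1 := hQ.transitionDensity_le_one ht (x i) (y j)
      simpa [abs_of_nonneg h0] using h1
  simpa [transitionDet] using h

theorem IsRateMatrix.hasDerivAt_transitionDet (hQ : IsRateMatrix Q N) (x y : Fin n → I) {t : ℝ}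
    (ht : 0 < t) : HasDerivAt (transitionDet Q y x)
      (∑ i, ∑ z ∈ N (x i), Q (x i) z * transitionDet Q y (Function.update x i z) t) t := by
  refine (HasDerivAt.matrix_det (A := fun t => Matrix.of fun i j : Fin n =>
    transitionDensity Q t (x i) (y j)) (A' := Matrix.of fun i j =>
      ∑ z ∈ N (x i), Q (x i) z * transitionDensity Q t z (y j))
    fun i j => hQ.hasDerivAt_transitionDensity ht (x i) (y j)).congr_deriv ?_
  refine Finset.sum_congr rfl fun i _ => ?_
  refine (Matrix.det_updateRow_sum_smul _ i (N (x i)) (Q (x i))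
    fun z j => transitionDensity Q t z (y j)).trans ?_
  refine Finset.sum_congr rfl fun z _ => ?_
  congr 2
  ext a b
  rcases eq_or_ne a i with rfl | ha
  · simp
  · simp [ha]

theorem isSubMarkovKernel_karlinMcGregor (hQ : IsRateMatrix Q N) (hf : IsLyapunov Q N f)
    (hN : ∀ x y z, z ∈ N x → (x < y → z ≤ y) ∧ (y < x → y ≤ z)) (n : ℕ) {t : ℝ} (ht : 0 ≤ t) :
    IsSubMarkovKernel (karlinMcGregor (transitionDensity Q) n t) := by
  have hnn : ∀ x y, 0 ≤ karlinMcGregor (transitionDensity Q) n t x y := by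
    intro x y
    refine nonneg_of_supersolution_chamber hQ hf hN (C := n.factorial) (u := transitionDet Q y.1)
      (fun x => hQ.continuousOn_transitionDet x y.1)
      (fun x t ht => hQ.hasDerivAt_transitionDet x y.1 ht)
      (fun x t ht => (abs_le.1 (hQ.abs_transitionDet_le x y.1 ht)).1)
      (fun x t _ => le_rfl) (fun x hx => ?_)
      (fun x hx t _ => (transitionDet_eq_zero hx y.1 t).ge) x.2 ht
    rw [transitionDet_zero hx y.2]
    split_ifs <;> norm_num
  have hmass : ∀ x (B : Finset (Weyl I n)),
      ∑ y ∈ B, karlinMcGregor (transitionDensity Q) n t x y ≤ 1 := by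
    intro x B
    rw [← sub_nonneg]
    refine nonneg_of_supersolution_chamber hQ hf hN (C := B.card * n.factorial)
      (u := fun x t => 1 - ∑ y ∈ B, transitionDet Q y.1 x t)
      (u' := fun x t => -∑ y ∈ B, ∑ i, ∑ z ∈ N (x i), Q (x i) z *
        transitionDet Q y.1 (Function.update x i z) t)
      (fun x => continuousOn_const.sub (continuousOn_finsetSum _ fun y _ =>
        hQ.continuousOn_transitionDet x y.1))
      (fun x t ht => (HasDerivAt.fun_sum fun y _ =>
        hQ.hasDerivAt_transitionDet x y.1 ht).const_sub 1)
      (fun x t ht => ?_) (fun x t _ => ?_) (fun x hx => ?_) (fun x hx t _ => ?_) x.2 ht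
    · have h : ∑ y ∈ B, transitionDet Q y.1 x t ≤ ∑ _y ∈ B, (n.factorial : ℝ) :=
        Finset.sum_le_sum fun y _ => (abs_le.1 (hQ.abs_transitionDet_le x y.1 ht)).2
      rw [Finset.sum_const, nsmul_eq_mul] at h
      linarith
    · have h1 : ∑ i, ∑ z ∈ N (x i), Q (x i) z ≤ 0 :=
        Finset.sum_nonpos fun i _ => hQ.row_sum_nonpos (x i)
      have h2 : ∑ i, ∑ z ∈ N (x i), Q (x i) z *
          (1 - ∑ y ∈ B, transitionDet Q y.1 (Function.update x i z) t) =
          ∑ i, ∑ z ∈ N (x i), Q (x i) z - ∑ y ∈ B, ∑ i, ∑ z ∈ N (x i), Q (x i) z *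
            transitionDet Q y.1 (Function.update x i z) t := by
        simp only [mul_sub, mul_one, Finset.sum_sub_distrib, Finset.mul_sum]
        congr 1
        rw [Finset.sum_comm (s := B)]
        exact Finset.sum_congr rfl fun i _ => Finset.sum_comm
      rw [h2]
      linarith
    · classical
      obtain ⟨x', rfl⟩ : ∃ x' : Weyl I n, x'.1 = x := ⟨⟨x, hx⟩, rfl⟩
      have h : ∑ y ∈ B, transitionDet Q y.1 x'.1 0 = ∑ y ∈ B, if x' = y then 1 else 0 :=
        Finset.sum_congr rfl fun y _ => by
          rw [transitionDet_zero hx y.2]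
          exact if_congr Subtype.val_injective.eq_iff rfl rfl
      rw [h, Finset.sum_ite_eq]
      split_ifs <;> norm_num
    · simp [transitionDet_eq_zero hx]
  refine ⟨hnn, fun x => ?_⟩
  have hs : Summable (karlinMcGregor (transitionDensity Q) n t x) :=
    summable_of_sum_le (hnn x) (hmass x)
  exact ⟨hs, hs.tsum_le_of_sum_le (hmass x)⟩

end KarlinMcGregor

/-! ### Sums of determinants over boxes -/

theorem HasSum.mul_prod {α β : Type} {f : α → ℝ} {g : β → ℝ} {a b : ℝ} (hf : HasSum f a)
    (hg : HasSum g b) : HasSum (fun q : α × β => f q.1 * g q.2) (a * b) :=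
  hf.mul hg (summable_mul_of_summable_norm hf.summable.norm hg.summable.norm)

theorem hasSum_prod_apply {I : Type} {m : ℕ} {b : Fin m → I → ℝ} (hb : ∀ j, Summable (b j)) :
    HasSum (fun y : Fin m → I => ∏ j, b j (y j)) (∏ j, ∑' u, b j u) := by
  induction m with
  | zero => simp
  | succ m ih =>
    have h2 := HasSum.mul_prod (hb 0).hasSum (ih (b := fun j => b j.succ) fun j => hb j.succ)
    rw [Fin.prod_univ_succ, ← (Fin.consEquiv fun _ : Fin (m + 1) => I).hasSum_iff]
    refine h2.congr_fun fun q => ?_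
    simp [Fin.prod_univ_succ, Fin.consEquiv]

theorem hasSum_det_apply {I : Type} {m : ℕ} {b : Fin m → Fin m → I → ℝ}
    (hb : ∀ i j, Summable (b i j)) :
    HasSum (fun y : Fin m → I => (Matrix.of fun i j => b i j (y j)).det)
      (Matrix.of fun i j => ∑' u, b i j u).det := by
  simp only [Matrix.det_apply', Matrix.of_apply]
  exact hasSum_sum fun σ _ => (hasSum_prod_apply fun j => hb (σ j) j).mul_left _

open Classical in
/-- The determinants `det (a_i(y_j))` are summed over the tuples with `y_j ∈ S_j` for all `j` column
by column, if all these tuples are increasing. -/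
theorem hasSum_weyl_det {I : Type} [LinearOrder I] {m : ℕ} {a : Fin m → I → ℝ}
    (ha : ∀ i, Summable (a i)) (S : Fin m → I → Prop)
    (hS : ∀ y : Fin m → I, (∀ j, S j (y j)) → StrictMono y) :
    HasSum (fun y : Weyl I m => if ∀ j, S j (y.1 j) then (Matrix.of fun i j => a i (y.1 j)).det else 0)
      (Matrix.of fun i j => ∑' u, if S j u then a i u else 0).det := by
  have h := hasSum_det_apply (b := fun i j u => if S j u then a i u else 0) fun i j =>
    ((ha i).indicator {u | S j u}).congr fun u => by simp [Set.indicator]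
  have heq : ∀ y : Fin m → I, (Matrix.of fun i j => if S j (y j) then a i (y j) else 0).det =
      if ∀ j, S j (y j) then (Matrix.of fun i j => a i (y j)).det else 0 := by
    intro y
    split_ifs with hy
    · simp only [hy, if_true]
    · push Not at hy
      obtain ⟨j, hj⟩ := hy
      exact Matrix.det_eq_zero_of_column_eq_zero j fun i => by simp [hj]
  simp only [heq] at h
  refine (hasSum_subtype_iff_of_support_subset (s := {y : Fin m → I | StrictMono y}) ?_).2 h
  intro y hy
  by_contra hmono
  refine hy (if_neg fun hall => hmono (hS y hall))

/-! ### Determinant identities for differences of consecutive rows and columns -/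

theorem Matrix.det_eq_of_forall_col_eq_add_succ {n : ℕ}
    {A B : Matrix (Fin (n + 1)) (Fin (n + 1)) ℝ}
    (hlast : ∀ i, A i (Fin.last n) = B i (Fin.last n))
    (hsucc : ∀ i (j : Fin n), A i j.castSucc = B i j.castSucc + A i j.succ) : A.det = B.det := by
  rw [← Matrix.det_submatrix_equiv_self Fin.revPerm A, ← Matrix.det_submatrix_equiv_self Fin.revPerm B]
  refine Matrix.det_eq_of_forall_col_eq_smul_add_pred (fun _ => 1) (fun i => ?_) fun i j => ?_
  · simpa using hlast i.rev
  · simpa [Fin.rev_succ, Fin.rev_castSucc] using hsucc i.rev j.rev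

/-- A determinant with a last column of ones is, up to transposition, that of the differences of
consecutive rows. -/
theorem Matrix.det_eq_det_sub_of_last_col_one {n : ℕ} {M : Matrix (Fin (n + 1)) (Fin (n + 1)) ℝ}
    (hM : ∀ i, M i (Fin.last n) = 1) :
    M.det = (Matrix.of fun i j : Fin n =>
      M j.castSucc i.castSucc - M j.succ i.castSucc).det := by
  have h1 : M.det = (Matrix.of fun i j : Fin (n + 1) =>
      Fin.cases (M 0 j) (fun k => M k.succ j - M k.castSucc j) i).det := by
    refine Matrix.det_eq_of_forall_row_eq_smul_add_pred (fun _ => 1) (fun j => ?_) fun i j => ?_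
    · simp
    · simp
  rw [h1, Matrix.det_succ_column _ (Fin.last n), Fin.sum_univ_succ, Finset.sum_eq_zero]
  · have h2 : (Matrix.submatrix (Matrix.of fun i j : Fin (n + 1) =>
        (Fin.cases (M 0 j) (fun k => M k.succ j - M k.castSucc j) i : ℝ))
        (Fin.succAbove 0) (Fin.succAbove (Fin.last n))) =
        -(Matrix.of fun i j : Fin n => M j.castSucc i.castSucc - M j.succ i.castSucc).transpose := by
      ext i j
      simp
    rw [h2, Matrix.det_neg, Matrix.det_transpose]
    simp only [Matrix.of_apply, Fin.cases_zero, hM, Fin.val_zero, Fin.val_last, zero_add, mul_one,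
      Fintype.card_fin, add_zero]
    rw [← mul_assoc, ← mul_pow]
    norm_num
  · intro k _
    simp [hM]

/-! ### Composition of positive kernels -/

section Kernels

variable {α β γ δ : Type}

theorem summable_kernel_comp_iff {A : β → ℝ} {B : β → γ → ℝ} {s : γ → ℝ} (hA : ∀ y, 0 ≤ A y)
    (hB : ∀ y z, 0 ≤ B y z) (hs : ∀ z, HasSum (fun y => A y * B y z) (s z)) (f : γ → ℝ) :
    (Summable fun q : β × γ => A q.1 * B q.1 q.2 * f q.2) ↔ Summable fun z => s z * |f z| := by
  rw [← summable_abs_iff, ← (Equiv.prodComm γ β).summable_iff, summable_prod_of_nonneg]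
  swap
  · exact fun q => abs_nonneg _
  have h : ∀ z y, |A y * B y z * f z| = A y * B y z * |f z| := fun z y => by
    rw [abs_mul, abs_of_nonneg (mul_nonneg (hA y) (hB y z))]
  have hsum : ∀ z, HasSum (fun y => A y * B y z * |f z|) (s z * |f z|) := fun z =>
    (hs z).mul_right _
  simp only [Function.comp_apply, Equiv.prodComm_apply, Prod.swap, h]
  simp only [(hsum _).tsum_eq]
  exact ⟨fun h => h.2, fun h => ⟨fun z => (hsum z).summable, h⟩⟩

theorem tsum_kernel_comp {A : β → ℝ} {B : β → γ → ℝ} {s : γ → ℝ}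
    (hs : ∀ z, HasSum (fun y => A y * B y z) (s z)) {f : γ → ℝ}
    (hf : Summable fun q : β × γ => A q.1 * B q.1 q.2 * f q.2) :
    ∑' y, A y * ∑' z, B y z * f z = ∑' z, s z * f z := by
  have h1 : ∀ y, A y * ∑' z, B y z * f z = ∑' z, A y * B y z * f z := fun y => by
    rw [← tsum_mul_left]
    simp only [mul_assoc]
  have h2 : ∀ z, s z * f z = ∑' y, A y * B y z * f z := fun z => ((hs z).mul_right _).tsum_eq.symm
  simp only [h1, h2]
  exact (Summable.tsum_comm (f := fun y z => A y * B y z * f z) hf).symm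

/-- Positive kernels with equal composed entries satisfy the intertwining relation, by Tonelli and
Fubini. -/
theorem kernelsIntertwine_of_hasSum {A : α → β → ℝ} {B : β → γ → ℝ} {C : α → δ → ℝ} {D : δ → γ → ℝ}
    (hA : ∀ x y, 0 ≤ A x y) (hB : ∀ x y, 0 ≤ B x y) (hC : ∀ x y, 0 ≤ C x y)
    (hD : ∀ x y, 0 ≤ D x y) (s : α → γ → ℝ)
    (hAB : ∀ x z, HasSum (fun y => A x y * B y z) (s x z))
    (hCD : ∀ x z, HasSum (fun y => C x y * D y z) (s x z)) : KernelsIntertwine A B C D where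
  summable_left x z := (hAB x z).summable
  summable_right x z := (hCD x z).summable
  entry_eq x z := (hAB x z).tsum_eq.trans (hCD x z).tsum_eq.symm
  summable_iff f x := (summable_kernel_comp_iff (hA x) hB (hAB x) f).trans
    (summable_kernel_comp_iff (hC x) hD (hCD x) f).symm
  op_eq f x hf := by
    have hf' := (summable_kernel_comp_iff (hA x) hB (hAB x) f).2
      ((summable_kernel_comp_iff (hC x) hD (hCD x) f).1 hf)
    exact (tsum_kernel_comp (hAB x) hf').trans (tsum_kernel_comp (hCD x) hf).symm

end Kernels

/-! ### Intertwining from duality and reversibility -/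

/-- Reversibility lets the starting points and end points of a Karlin–McGregor determinant be
exchanged. -/
theorem prod_mul_det_eq_of_reversible {I : Type} {n : ℕ} {w : I → ℝ} {q : I → I → ℝ}
    (hrev : ∀ x y, w x * q x y = w y * q y x) (y z : Fin n → I) :
    (∏ i, w (y i)) * (Matrix.of fun i j => q (y i) (z j)).det =
      (∏ i, w (z i)) * (Matrix.of fun i j => q (z i) (y j)).det := by
  rw [← Matrix.det_mul_column (fun i => w (y i)) (Matrix.of fun i j => q (y i) (z j)),
    ← Matrix.det_transpose (Matrix.of fun i j => q (z i) (y j)),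
    ← Matrix.det_mul_row (fun i => w (z i))]
  congr 1
  ext i j
  simp [hrev]

theorem tsum_ite_eq_add {I : Type} {a : I → ℝ} (ha : Summable a) {P R T : I → Prop}
    {_ : DecidablePred P} {_ : DecidablePred R} {_ : DecidablePred T}
    (h : ∀ u, (T u ↔ P u ∨ R u) ∧ ¬ (P u ∧ R u)) :
    ∑' u, (if T u then a u else 0) =
      ∑' u, (if P u then a u else 0) + ∑' u, if R u then a u else 0 := by
  have hs : ∀ (S : I → Prop) [DecidablePred S], Summable fun u => if S u then a u else 0 :=
    fun S _ => (ha.indicator {u | S u}).congr fun u => by simp [Set.indicator]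
  rw [← (hs P).tsum_add (hs R)]
  refine tsum_congr fun u => ?_
  have := h u
  by_cases hP : P u <;> by_cases hR : R u <;> simp_all

theorem tsum_ite_congr {I : Type} {a : I → ℝ} {P T : I → Prop} {_ : DecidablePred P}
    {_ : DecidablePred T} (h : ∀ u, T u ↔ P u) :
    ∑' u, (if T u then a u else 0) = ∑' u, if P u then a u else 0 :=
  tsum_congr fun u => if_congr (h u) rfl rfl

section Intertwining

variable {I : Type} [LinearOrder I] {n : ℕ}

open Classical in
/-- `det P_t(x_i, ·)` summed over the `y ∈ W^{n+1}` with `z ≺ y`: the intervals `(z_{j-1}, z_j]`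
are merged into the half-lines `(-∞, z_j]`, the last of which is the whole of `I`. -/
theorem hasSum_det_interlaceSucc {q : I → I → ℝ} (hq : ∀ x, Summable (q x))
    (hmass : ∀ x, ∑' u, q x u = 1) (x : Weyl I (n + 1)) (z : Weyl I n) :
    HasSum (fun y : Weyl I (n + 1) => if InterlaceSucc y z then
        (Matrix.of fun i j => q (x.1 i) (y.1 j)).det else 0)
      (Matrix.of fun i j : Fin n => ∑' u, (if u ≤ z.1 i then q (x.1 j.castSucc) u else 0) -
        ∑' u, if u ≤ z.1 i then q (x.1 j.succ) u else 0).det := by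
  have h := hasSum_weyl_det (a := fun i => q (x.1 i)) (fun i => hq (x.1 i))
    (fun j u => (∀ i : Fin n, i.succ = j → z.1 i < u) ∧ ∀ i : Fin n, i.castSucc = j → u ≤ z.1 i)
    (fun y hy => Fin.strictMono_iff_lt_succ.2 fun i =>
      ((hy i.castSucc).2 i rfl).trans_lt ((hy i.succ).1 i rfl))
  have hiff : ∀ y : Weyl I (n + 1), (∀ j, (∀ i : Fin n, i.succ = j → z.1 i < y.1 j) ∧
      ∀ i : Fin n, i.castSucc = j → y.1 j ≤ z.1 i) ↔ InterlaceSucc y z := fun y =>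
    ⟨fun hy i => ⟨(hy _).2 i rfl, (hy _).1 i rfl⟩,
      fun hy j => ⟨fun i hi => hi ▸ (hy i).2, fun i hi => hi ▸ (hy i).1⟩⟩
  simp only [hiff] at h
  convert h using 1
  set M : Matrix (Fin (n + 1)) (Fin (n + 1)) ℝ := Matrix.of fun i j =>
    ∑' u, if (∀ k : Fin n, k.castSucc = j → u ≤ z.1 k) then q (x.1 i) u else 0 with hM
  have hcast : ∀ i (j : Fin n), M i j.castSucc = ∑' u, if u ≤ z.1 j then q (x.1 i) u else 0 := by
    intro i j
    simp [hM]
  have hlast : ∀ i, M i (Fin.last n) = 1 := by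
    intro i
    simp [hM, Fin.castSucc_ne_last, hmass]
  have hdiff := Matrix.det_eq_det_sub_of_last_col_one hlast
  simp only [hcast] at hdiff
  rw [← hdiff]
  refine Matrix.det_eq_of_forall_col_eq_smul_add_pred (fun _ => 1) (fun i => ?_) fun i j => ?_
  · simp [hM, Fin.succ_ne_zero]
  · rw [one_mul, hcast, Matrix.of_apply]
    refine tsum_ite_eq_add (hq _) fun u => ⟨⟨fun hT => ?_, ?_⟩, fun hu => ?_⟩
    · rcases lt_or_ge (z.1 j) u with hu | hu
      · exact Or.inl ⟨fun i hi => (Fin.succ_injective _ hi) ▸ hu, hT⟩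
      · exact Or.inr hu
    · rintro (hu | hu) k hk
      · exact hu.2 k hk
      · refine hu.trans (z.2.monotone ?_)
        have := congrArg Fin.val hk
        simp only [Fin.val_castSucc, Fin.val_succ] at this
        exact Fin.le_def.2 (by omega)
    · exact absurd (hu.1.1 j rfl) (not_lt.2 hu.2)

open Classical in
/-- `det Q(z_i, ·)` summed over the `y ∈ W^n` with `y ≺ x`, `x ∈ W^{n+1}`: the interval
`[x_j, x_{j+1})` is a difference of half-lines. -/
theorem hasSum_det_interlaceSucc' {q : I → I → ℝ} (hq : ∀ x, Summable (q x))
    (x : Weyl I (n + 1)) (z : Weyl I n) :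
    HasSum (fun y : Weyl I n => if InterlaceSucc x y then
        (Matrix.of fun i j => q (z.1 i) (y.1 j)).det else 0)
      (Matrix.of fun i j : Fin n => ∑' u, (if x.1 j.castSucc ≤ u then q (z.1 i) u else 0) -
        ∑' u, if x.1 j.succ ≤ u then q (z.1 i) u else 0).det := by
  have h := hasSum_weyl_det (a := fun i => q (z.1 i)) (fun i => hq (z.1 i))
    (fun j u => x.1 j.castSucc ≤ u ∧ u < x.1 j.succ) (fun y hy => by
      rcases n with _ | n
      · exact fun a => a.elim0
      · refine Fin.strictMono_iff_lt_succ.2 fun i => (hy i.castSucc).2.trans_le ?_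
        rw [Fin.succ_castSucc]
        exact (hy i.succ).1)
  have hiff : ∀ y : Weyl I n, (∀ j : Fin n, x.1 j.castSucc ≤ y.1 j ∧ y.1 j < x.1 j.succ) ↔
      InterlaceSucc x y := fun y => Iff.rfl
  simp only [hiff] at h
  convert h using 1
  congr 1
  ext i j
  rw [Matrix.of_apply, Matrix.of_apply, sub_eq_iff_eq_add]
  refine tsum_ite_eq_add (hq _) fun u => ⟨⟨fun hu => ?_, ?_⟩, fun hu => ?_⟩
  · rcases lt_or_ge u (x.1 j.succ) with h | h
    · exact Or.inl ⟨hu, h⟩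
    · exact Or.inr h
  · rintro (hu | hu)
    · exact hu.1
    · exact (x.2.monotone (Fin.castSucc_lt_succ).le).trans hu
  · exact absurd hu.2 (not_le.2 hu.1.2)

theorem strictMono_of_lt_of_val_eq_add_one {y : Fin n → I}
    (h : ∀ i j : Fin n, (j : ℕ) = i + 1 → y i < y j) : StrictMono y := by
  rcases n with _ | n
  · exact fun a => a.elim0
  · exact Fin.strictMono_iff_lt_succ.2 fun i => h _ _ (by simp)

open Classical in
/-- `det Q(x_i, ·)` summed over the `y ∈ W^n` with `z ≺ y`, `z ∈ W^n`: the intervals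
`[z_j, z_{j+1})` are merged into the half-lines `[z_j, ∞)`. -/
theorem hasSum_det_interlaceSame {q : I → I → ℝ} (hq : ∀ x, Summable (q x)) (x z : Weyl I n) :
    HasSum (fun y : Weyl I n => if InterlaceSame y z then
        (Matrix.of fun i j => q (x.1 i) (y.1 j)).det else 0)
      (Matrix.of fun i j : Fin n => ∑' u, if z.1 j ≤ u then q (x.1 i) u else 0).det := by
  have h := hasSum_weyl_det (a := fun i => q (x.1 i)) (fun i => hq (x.1 i))
    (fun i u => z.1 i ≤ u ∧ ∀ j : Fin n, (j : ℕ) = i + 1 → u < z.1 j)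
    (fun y hy => strictMono_of_lt_of_val_eq_add_one fun i j hij =>
      ((hy i).2 j hij).trans_le (hy j).1)
  have hiff : ∀ y : Weyl I n, (∀ i, z.1 i ≤ y.1 i ∧ ∀ j : Fin n, (j : ℕ) = i + 1 → y.1 i < z.1 j) ↔
      InterlaceSame y z := fun y =>
    ⟨fun hy => ⟨fun i => (hy i).1, fun i => (hy i).2⟩, fun hy i => ⟨hy.1 i, hy.2 i⟩⟩
  simp only [hiff] at h
  convert h using 1
  rcases n with _ | n
  · simp
  refine Matrix.det_eq_of_forall_col_eq_add_succ (fun i => ?_) fun i j => ?_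
  · rw [Matrix.of_apply, Matrix.of_apply]
    refine (tsum_ite_congr fun u => ⟨fun hu => hu.1, fun hu => ⟨hu, fun j hj => ?_⟩⟩).symm
    simp only [Fin.val_last] at hj
    omega
  · simp only [Matrix.of_apply]
    refine tsum_ite_eq_add (hq _) fun u => ⟨⟨fun hu => ?_, ?_⟩, fun hu => ?_⟩
    · rcases lt_or_ge u (z.1 j.succ) with h | h
      · refine Or.inl ⟨hu, fun k hk => ?_⟩
        rwa [show k = j.succ from Fin.ext (by simpa using hk)]
      · exact Or.inr h
    · rintro (hu | hu)
      · exact hu.1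
      · exact (z.2.monotone (Fin.castSucc_lt_succ).le).trans hu
    · exact absurd hu.2 (not_le.2 (hu.1.2 j.succ (by simp)))

open Classical in
/-- `det P(z_i, ·)` summed over the `y ∈ W^n` with `y ≺ x`, `x ∈ W^n`: the intervals
`(x_{j-1}, x_j]` are merged into the half-lines `(-∞, x_j]`. -/
theorem hasSum_det_interlaceSame' {q : I → I → ℝ} (hq : ∀ x, Summable (q x)) (x z : Weyl I n) :
    HasSum (fun y : Weyl I n => if InterlaceSame x y then
        (Matrix.of fun i j => q (z.1 i) (y.1 j)).det else 0)
      (Matrix.of fun i j : Fin n => ∑' u, if u ≤ x.1 j then q (z.1 i) u else 0).det := by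
  have h := hasSum_weyl_det (a := fun i => q (z.1 i)) (fun i => hq (z.1 i))
    (fun j u => u ≤ x.1 j ∧ ∀ i : Fin n, (j : ℕ) = i + 1 → x.1 i < u)
    (fun y hy => strictMono_of_lt_of_val_eq_add_one fun i j hij =>
      (hy i).1.trans_lt ((hy j).2 i hij))
  have hiff : ∀ y : Weyl I n, (∀ j, y.1 j ≤ x.1 j ∧ ∀ i : Fin n, (j : ℕ) = i + 1 → x.1 i < y.1 j) ↔
      InterlaceSame x y := fun y =>
    ⟨fun hy => ⟨fun i => (hy i).1, fun i j => (hy j).2 i⟩, fun hy j => ⟨hy.1 j, fun i => hy.2 i j⟩⟩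
  simp only [hiff] at h
  convert h using 1
  rcases n with _ | n
  · simp
  refine Matrix.det_eq_of_forall_col_eq_smul_add_pred (fun _ => 1) (fun i => ?_) fun i j => ?_
  · rw [Matrix.of_apply, Matrix.of_apply]
    refine (tsum_ite_congr fun u => ⟨fun hu => hu.1, fun hu => ⟨hu, fun j hj => ?_⟩⟩).symm
    simp at hj
  · simp only [Matrix.of_apply, one_mul]
    refine tsum_ite_eq_add (hq _) fun u => ⟨⟨fun hu => ?_, ?_⟩, fun hu => ?_⟩
    · rcases lt_or_ge (x.1 j.castSucc) u with h | h
      · refine Or.inl ⟨hu, fun k hk => ?_⟩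
        rwa [show k = j.castSucc from Fin.ext (by simpa using hk.symm)]
      · exact Or.inr h
    · rintro (hu | hu)
      · exact hu.1
      · exact hu.trans (x.2.monotone (Fin.castSucc_lt_succ).le)
    · exact absurd hu.2 (not_le.2 (hu.1.2 j.castSucc (by simp)))

variable {p ph : ℝ → I → I → ℝ} {t : ℝ} {w : I → ℝ}

theorem kernelsIntertwine_lambdaSucc
    (hp : ∀ x, Summable (p t x)) (hph : ∀ x, Summable (ph t x)) (hmass : ∀ x, ∑' u, p t x u = 1)
    (hdual : ∀ x z, ∑' u, (if u ≤ z then p t x u else 0) = ∑' u, if x ≤ u then ph t z u else 0)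
    (hw : ∀ x, 0 ≤ w x) (hrev : ∀ x y, w x * ph t x y = w y * ph t y x)
    (hP : ∀ x y, 0 ≤ karlinMcGregor p (n + 1) t x y) (hPh : ∀ x y, 0 ≤ karlinMcGregor ph n t x y) :
    KernelsIntertwine (karlinMcGregor p (n + 1) t) (lambdaSucc w n) (lambdaSucc w n)
      (karlinMcGregor ph n t) := by
  have hL : ∀ (x : Weyl I (n + 1)) (y : Weyl I n), 0 ≤ lambdaSucc w n x y := fun x y => by
    unfold lambdaSucc
    split_ifs
    · exact Finset.prod_nonneg fun i _ => hw _
    · exact le_rfl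
  refine kernelsIntertwine_of_hasSum hP hL hL hPh (fun x z => (∏ i, w (z.1 i)) *
    (Matrix.of fun i j : Fin n => ∑' u, (if u ≤ z.1 i then p t (x.1 j.castSucc) u else 0) -
        ∑' u, if u ≤ z.1 i then p t (x.1 j.succ) u else 0).det) (fun x z => ?_) fun x z => ?_
  · refine ((hasSum_det_interlaceSucc hp hmass x z).mul_left (∏ i, w (z.1 i))).congr_fun fun y => ?_
    simp only [lambdaSucc, karlinMcGregor, mul_ite, mul_zero]
    split_ifs
    · exact mul_comm _ _
    · rfl
  · simp only [hdual]
    refine ((hasSum_det_interlaceSucc' hph x z).mul_left (∏ i, w (z.1 i))).congr_fun fun y => ?_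
    simp only [lambdaSucc, karlinMcGregor, mul_ite, mul_zero, ite_mul, zero_mul]
    split_ifs
    · exact prod_mul_det_eq_of_reversible hrev y.1 z.1
    · rfl

theorem kernelsIntertwine_lambdaSame
    (hp : ∀ x, Summable (p t x)) (hph : ∀ x, Summable (ph t x))
    (hdual : ∀ x z, ∑' u, (if u ≤ z then p t x u else 0) = ∑' u, if x ≤ u then ph t z u else 0)
    (hw : ∀ x, 0 ≤ w x) (hrev : ∀ x y, w x * p t x y = w y * p t y x)
    (hP : ∀ x y, 0 ≤ karlinMcGregor p n t x y) (hPh : ∀ x y, 0 ≤ karlinMcGregor ph n t x y) :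
    KernelsIntertwine (karlinMcGregor ph n t) (lambdaSame w n) (lambdaSame w n)
      (karlinMcGregor p n t) := by
  have hL : ∀ x y : Weyl I n, 0 ≤ lambdaSame w n x y := fun x y => by
    unfold lambdaSame
    split_ifs
    · exact Finset.prod_nonneg fun i _ => hw _
    · exact le_rfl
  refine kernelsIntertwine_of_hasSum hPh hL hL hP (fun x z => (∏ i, w (z.1 i)) *
    (Matrix.of fun i j : Fin n => ∑' u, if z.1 j ≤ u then ph t (x.1 i) u else 0).det)
    (fun x z => ?_) fun x z => ?_
  · refine ((hasSum_det_interlaceSame hph x z).mul_left (∏ i, w (z.1 i))).congr_fun fun y => ?_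
    simp only [lambdaSame, karlinMcGregor, mul_ite, mul_zero]
    split_ifs
    · exact mul_comm _ _
    · rfl
  · have h := (hasSum_det_interlaceSame' hp x z).mul_left (∏ i, w (z.1 i))
    rw [← Matrix.det_transpose] at h
    simp only [hdual] at h
    refine h.congr_fun fun y => ?_
    simp only [lambdaSame, karlinMcGregor, mul_ite, mul_zero, ite_mul, zero_mul]
    split_ifs
    · exact prod_mul_det_eq_of_reversible hrev y.1 z.1
    · rfl

end Intertwining

/-- Karlin–McGregor kernels of two dual chains: everything follows from Siegmund duality of the rate
matrices, with respect to `1(x ≤ v)`, detailed balance, and the absence of explosion. -/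
theorem karlinMcGregor_intertwining {I : Type} [LinearOrder I] {Q Qd : I → I → ℝ}
    {N Nd : I → Finset I} {f g m md : I → ℝ}
    (hQ : IsRateMatrix Q N) (hf : IsLyapunov Q N f)
    (hQd : IsRateMatrix Qd Nd) (hg : IsLyapunov Qd Nd g)
    (hN : ∀ x y z, z ∈ N x → (x < y → z ≤ y) ∧ (y < x → y ≤ z))
    (hNd : ∀ x y z, z ∈ Nd x → (x < y → z ≤ y) ∧ (y < x → y ≤ z))
    (hrow : ∀ x, ∑ z ∈ N x, Q x z = 0)
    (hdual : ∀ x v, ∑ w ∈ Nd v, Qd v w * (if x ≤ w then 1 else 0) =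
      ∑ z ∈ N x, Q x z * (if z ≤ v then 1 else 0))
    (hm : ∀ x, 0 < m x) (hrev : ∀ x y, m x * Q x y = m y * Q y x)
    (hmd : ∀ x, 0 < md x) (hrevd : ∀ x y, md x * Qd x y = md y * Qd y x)
    (n : ℕ) {t : ℝ} (ht : 0 ≤ t) :
    IsSubMarkovKernel (karlinMcGregor (transitionDensity Q) n t) ∧
    IsSubMarkovKernel (karlinMcGregor (transitionDensity Qd) n t) ∧
    KernelsIntertwine
      (karlinMcGregor (transitionDensity Q) (n + 1) t) (lambdaSucc md n)
      (lambdaSucc md n) (karlinMcGregor (transitionDensity Qd) n t) ∧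
    KernelsIntertwine
      (karlinMcGregor (transitionDensity Qd) n t) (lambdaSame m n)
      (lambdaSame m n) (karlinMcGregor (transitionDensity Q) n t) := by
  have hP := fun k => isSubMarkovKernel_karlinMcGregor hQ hf hN k ht
  have hPd := fun k => isSubMarkovKernel_karlinMcGregor hQd hg hNd k ht
  have hs := fun x => hf.summable_transitionDensity hQ ht x
  have hsd := fun x => hg.summable_transitionDensity hQd ht x
  have hD : ∀ x z, ∑' u, (if u ≤ z then transitionDensity Q t x u else 0) =
      ∑' u, if x ≤ u then transitionDensity Qd t z u else 0 := by
    intro x z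
    have h := tsum_transitionDensity_mul_eq (H := fun x v : I => if x ≤ v then (1 : ℝ) else 0)
      hQ hf hQd hg (fun x v => by split_ifs <;> norm_num)
      (fun x v => by split_ifs <;> norm_num) hdual ht x z
    simpa only [mul_ite, mul_one, mul_zero] using h.symm
  refine ⟨hP n, hPd n, ?_, ?_⟩
  · exact kernelsIntertwine_lambdaSucc hs hsd
      (fun x => hf.tsum_transitionDensity_eq_one hQ hrow ht x)
      hD (fun x => (hmd x).le)
      (fun x y => hg.transitionDensity_reversible hQd hmd hrevd ht x y) (hP (n + 1)).1 (hPd n).1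
  · exact kernelsIntertwine_lambdaSame hs hsd hD (fun x => (hm x).le)
      (fun x y => hf.transitionDensity_reversible hQ hm hrev ht x y) (hP n).1 (hPd n).1

/-! ### Birth and death chains on the integers -/

theorem exists_lt_sum_of_tsum_ofReal_eq_top {ι : Type*} {a : ι → ℝ} (ha : ∀ i, 0 ≤ a i)
    (h : ∑' i, ENNReal.ofReal (a i) = ∞) (C : ℝ) : ∃ s : Finset ι, C < ∑ i ∈ s, a i := by
  by_contra! hle
  have hs : Summable a := summable_of_sum_le ha hle
  rw [← ENNReal.ofReal_tsum_of_nonneg ha hs] at h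
  exact ENNReal.ofReal_ne_top h

/-- The states within distance one of an integer. -/
def intNbr (x : ℤ) : Finset ℤ := {x + 1, x, x - 1}

theorem sum_intNbr (lam mu a : ℤ → ℝ) (x : ℤ) : ∑ z ∈ intNbr x, bdGenerator lam mu x z * a z =
    lam x * a (x + 1) - (lam x + mu x) * a x + mu x * a (x - 1) := by
  rw [intNbr, Finset.sum_insert, Finset.sum_insert, Finset.sum_singleton]
  · have e1 : bdGenerator lam mu x (x + 1) = lam x := if_pos rfl
    have e2 : bdGenerator lam mu x x = -(lam x + mu x) := by
      rw [bdGenerator, if_neg (by omega), if_pos rfl]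
    have e3 : bdGenerator lam mu x (x - 1) = mu x := by
      rw [bdGenerator, if_neg (by omega), if_neg (by omega), if_pos (by omega)]
    rw [e1, e2, e3]
    ring
  · simp only [Finset.mem_singleton]
    omega
  · simp only [Finset.mem_insert, Finset.mem_singleton]
    omega

theorem isRateMatrix_int {lam mu : ℤ → ℝ} (hl : ∀ x, 0 ≤ lam x) (hm : ∀ x, 0 ≤ mu x) :
    IsRateMatrix (bdGenerator lam mu) intNbr where
  self_mem x := by simp [intNbr]
  eq_zero x z hz := by
    simp only [intNbr, Finset.mem_insert, Finset.mem_singleton, not_or] at hz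
    rw [bdGenerator, if_neg hz.1, if_neg hz.2.1, if_neg (by omega)]
  offdiag_nonneg x z hz := by
    rw [bdGenerator, if_neg hz]
    split_ifs
    exacts [hl x, hm x, le_rfl]
  row_sum_nonpos x := by
    have h := sum_intNbr lam mu (fun _ => 1) x
    simp only [mul_one] at h
    rw [h]
    linarith

theorem sum_intNbr_eq_zero (lam mu : ℤ → ℝ) (x : ℤ) :
    ∑ z ∈ intNbr x, bdGenerator lam mu x z = 0 := by
  have h := sum_intNbr lam mu (fun _ => 1) x
  simp only [mul_one] at h
  rw [h]
  ring

theorem intNbr_between (x y z : ℤ) (hz : z ∈ intNbr x) : (x < y → z ≤ y) ∧ (y < x → y ≤ z) := by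
  simp only [intNbr, Finset.mem_insert, Finset.mem_singleton] at hz
  omega

theorem bdGenerator_int_reversible {lam mu m : ℤ → ℝ}
    (h : ∀ x, m x * lam x = m (x + 1) * mu (x + 1)) (x y : ℤ) :
    m x * bdGenerator lam mu x y = m y * bdGenerator lam mu y x := by
  simp only [bdGenerator]
  rcases lt_trichotomy x y with hxy | rfl | hxy
  · by_cases h1 : y = x + 1
    · subst h1
      rw [if_pos rfl, if_neg (by omega), if_neg (by omega), if_pos rfl, h x]
    · rw [if_neg h1, if_neg (by omega), if_neg (by omega), if_neg (by omega), if_neg (by omega),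
        if_neg h1, mul_zero, mul_zero]
  · rfl
  · by_cases h1 : x = y + 1
    · subst h1
      rw [if_neg (by omega), if_neg (by omega), if_pos rfl, if_pos rfl, h y]
    · rw [if_neg (by omega), if_neg (by omega), if_neg h1, if_neg h1, if_neg (by omega),
        if_neg (by omega), mul_zero, mul_zero]

theorem bdGenerator_int_dual (lam mu : ℤ → ℝ) (x v : ℤ) :
    ∑ w ∈ intNbr v, bdGenerator (dualBirth lam mu) (dualDeath lam mu) v w *
      (if x ≤ w then 1 else 0) =
    ∑ z ∈ intNbr x, bdGenerator lam mu x z * (if z ≤ v then 1 else 0) := by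
  rw [sum_intNbr _ _ (fun w => if x ≤ w then (1 : ℝ) else 0),
    sum_intNbr _ _ (fun z => if z ≤ v then (1 : ℝ) else 0)]
  simp only [dualBirth, dualDeath]
  rcases lt_trichotomy x v with h | rfl | h
  · simp only [show x ≤ v + 1 by omega, show x ≤ v by omega, show x ≤ v - 1 by omega,
      show x + 1 ≤ v by omega, show x - 1 ≤ v by omega, if_true]
    ring
  · simp only [show x ≤ x + 1 by omega, le_refl, show ¬ x ≤ x - 1 by omega,
      show ¬ x + 1 ≤ x by omega, show x - 1 ≤ x by omega, if_true, if_false]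
    ring
  · by_cases h1 : x = v + 1
    · subst h1
      simp only [le_refl, show ¬ v + 1 ≤ v by omega, show ¬ v + 1 ≤ v - 1 by omega,
        show ¬ v + 1 + 1 ≤ v by omega, show v + 1 - 1 ≤ v by omega, if_true, if_false]
      ring
    · simp only [show ¬ x ≤ v + 1 by omega, show ¬ x ≤ v by omega, show ¬ x ≤ v - 1 by omega,
        show ¬ x + 1 ≤ v by omega, show ¬ x - 1 ≤ v by omega, if_false]
      ring

theorem intSymm_pos {lam mu : ℤ → ℝ} (hl : ∀ x, 0 < lam x) (hm : ∀ x, 0 < mu x) (x : ℤ) :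
    0 < intSymm lam mu x := by
  rw [intSymm]
  split_ifs
  · exact Finset.prod_pos fun i _ => div_pos (hl _) (hm _)
  · exact Finset.prod_pos fun i _ => div_pos (hm _) (hl _)

theorem intSymm_mul {lam mu : ℤ → ℝ} (hl : ∀ x, 0 < lam x) (hm : ∀ x, 0 < mu x) (x : ℤ) :
    intSymm lam mu x * lam x = intSymm lam mu (x + 1) * mu (x + 1) := by
  have hl0 := (hl x).ne'
  have hm0 := (hm (x + 1)).ne'
  rcases le_or_gt 0 x with hx | hx
  · obtain ⟨k, rfl⟩ := Int.eq_ofNat_of_zero_le hx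
    rw [intSymm, intSymm, if_pos hx, if_pos (by omega), show ((k : ℤ) + 1).toNat = k + 1 by omega,
      Int.toNat_natCast, Finset.prod_range_succ]
    field_simp
  · obtain ⟨k, rfl⟩ : ∃ k : ℕ, x = -(k + 1) := ⟨(-x - 1).toNat, by omega⟩
    have h1 : intSymm lam mu (-((k : ℤ) + 1)) = ∏ i ∈ Finset.range (k + 1),
        mu (-((k : ℤ) + 1) + i + 1) / lam (-((k : ℤ) + 1) + i) := by
      rw [intSymm, if_neg (by omega), show (- -((k : ℤ) + 1)).toNat = k + 1 by omega]
    have h2 : intSymm lam mu (-((k : ℤ) + 1) + 1) = ∏ i ∈ Finset.range k,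
        mu (-((k : ℤ) + 1) + (i + 1 : ℕ) + 1) / lam (-((k : ℤ) + 1) + (i + 1 : ℕ)) := by
      rcases Nat.eq_zero_or_pos k with rfl | hk
      · simp [intSymm]
      · rw [intSymm, if_neg (by omega), show (-(-((k : ℤ) + 1) + 1)).toNat = k by omega]
        refine Finset.prod_congr rfl fun i _ => ?_
        push_cast
        congr 2 <;> ring
    rw [h1, h2, Finset.prod_range_succ', Nat.cast_zero, add_zero]
    field_simp

/-- The function with increments `s_x M(x)`, where `M(x)` is the mass of `[1, x]`, or minus that of
`[x+1, -1]`. Then `Q f ≤ 1`, because `(M(x) - M(x-1)) / m(x) ≤ 1`. -/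
noncomputable def intLyapunov (m s : ℤ → ℝ) (x : ℤ) : ℝ :=
  1 + ∑ j ∈ Finset.Icc 1 (x - 1), s j * ∑ i ∈ Finset.Icc 1 j, m i +
    ∑ j ∈ Finset.Icc x (-1), s j * ∑ i ∈ Finset.Icc (j + 1) (-1), m i

theorem sum_Icc_add_one_right {a x : ℤ} (h : a ≤ x + 1) (F : ℤ → ℝ) :
    ∑ j ∈ Finset.Icc a (x + 1), F j = ∑ j ∈ Finset.Icc a x, F j + F (x + 1) := by
  have : Finset.Icc a (x + 1) = insert (x + 1) (Finset.Icc a x) := by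
    ext j
    simp only [Finset.mem_Icc, Finset.mem_insert]
    omega
  rw [this, Finset.sum_insert (by simp), add_comm]

theorem sum_Icc_eq_add_left {x b : ℤ} (h : x ≤ b) (F : ℤ → ℝ) :
    ∑ j ∈ Finset.Icc x b, F j = F x + ∑ j ∈ Finset.Icc (x + 1) b, F j := by
  have : Finset.Icc x b = insert x (Finset.Icc (x + 1) b) := by
    ext j
    simp only [Finset.mem_Icc, Finset.mem_insert]
    omega
  rw [this, Finset.sum_insert (by simp)]

theorem intLyapunov_add_one (m s : ℤ → ℝ) (x : ℤ) : intLyapunov m s (x + 1) - intLyapunov m s x =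
    s x * (∑ i ∈ Finset.Icc 1 x, m i - ∑ i ∈ Finset.Icc (x + 1) (-1), m i) := by
  unfold intLyapunov
  rcases le_or_gt x 0 with hx | hx
  · have e1 : Finset.Icc 1 (x + 1 - 1) = ∅ := Finset.Icc_eq_empty (by omega)
    have e2 : Finset.Icc 1 (x - 1) = ∅ := Finset.Icc_eq_empty (by omega)
    have e3 : Finset.Icc 1 x = ∅ := Finset.Icc_eq_empty (by omega)
    rw [e1, e2, e3]
    rcases hx.eq_or_lt with rfl | hx
    · simp
    · rw [sum_Icc_eq_add_left (x := x) (by omega)]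
      simp only [Finset.sum_empty]
      ring
  · have e1 : Finset.Icc (x + 1) (-1) = ∅ := Finset.Icc_eq_empty (by omega)
    have e2 : Finset.Icc x (-1) = ∅ := Finset.Icc_eq_empty (by omega)
    have h := sum_Icc_add_one_right (a := 1) (x := x - 1) (by omega)
      (fun j => s j * ∑ i ∈ Finset.Icc 1 j, m i)
    rw [sub_add_cancel] at h
    rw [e1, e2, add_sub_cancel_right, h]
    simp only [Finset.sum_empty]
    ring

theorem isLyapunov_int {lam mu m s : ℤ → ℝ} (hm : ∀ x, 0 < m x) (hs : ∀ x, 0 < s x)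
    (h1 : ∀ x, lam x * m x * s x = 1) (h2 : ∀ x, mu x * m x * s (x - 1) = 1)
    (htop : ∀ C : ℝ, ∃ k : ℤ, C < ∑ j ∈ Finset.Icc 1 k, s j * ∑ i ∈ Finset.Icc 1 j, m i)
    (hbot : ∀ C : ℝ, ∃ k : ℤ,
      C < ∑ j ∈ Finset.Icc k (-1), s j * ∑ i ∈ Finset.Icc (j + 1) (-1), m i) :
    IsLyapunov (bdGenerator lam mu) intNbr (intLyapunov m s) := by
  have hA : ∀ j, 0 ≤ s j * ∑ i ∈ Finset.Icc 1 j, m i := fun j =>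
    mul_nonneg (hs j).le (Finset.sum_nonneg fun i _ => (hm i).le)
  have hB : ∀ j, 0 ≤ s j * ∑ i ∈ Finset.Icc (j + 1) (-1), m i := fun j =>
    mul_nonneg (hs j).le (Finset.sum_nonneg fun i _ => (hm i).le)
  have hA' : ∀ x, 0 ≤ ∑ j ∈ Finset.Icc 1 (x - 1), s j * ∑ i ∈ Finset.Icc 1 j, m i := fun x =>
    Finset.sum_nonneg fun j _ => hA j
  have hB' : ∀ x, 0 ≤ ∑ j ∈ Finset.Icc x (-1), s j * ∑ i ∈ Finset.Icc (j + 1) (-1), m i :=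
    fun x => Finset.sum_nonneg fun j _ => hB j
  have hone : ∀ x, 1 ≤ intLyapunov m s x := fun x => by
    unfold intLyapunov
    linarith [hA' x, hB' x]
  refine ⟨fun x => zero_le_one.trans (hone x), fun x => ?_, fun c => ?_⟩
  · refine le_trans ?_ (hone x)
    rw [sum_intNbr]
    set M : ℤ → ℝ := fun x => ∑ i ∈ Finset.Icc 1 x, m i - ∑ i ∈ Finset.Icc (x + 1) (-1), m i with hM
    have d1 : intLyapunov m s (x + 1) - intLyapunov m s x = s x * M x := intLyapunov_add_one m s x
    have d2 : intLyapunov m s x - intLyapunov m s (x - 1) = s (x - 1) * M (x - 1) := by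
      have := intLyapunov_add_one m s (x - 1)
      simp only [sub_add_cancel] at this
      simpa only [hM, sub_add_cancel] using this
    have hstep : M x - M (x - 1) ≤ m x := by
      simp only [hM, sub_add_cancel]
      rcases lt_trichotomy x 0 with hx | rfl | hx
      · have e1 : Finset.Icc 1 x = ∅ := Finset.Icc_eq_empty (by omega)
        have e2 : Finset.Icc 1 (x - 1) = ∅ := Finset.Icc_eq_empty (by omega)
        rw [e1, e2, sum_Icc_eq_add_left (x := x) (by omega)]
        simp
      · simpa using (hm 0).le
      · have e1 : Finset.Icc (x + 1) (-1) = ∅ := Finset.Icc_eq_empty (by omega)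
        have e2 : Finset.Icc x (-1) = ∅ := Finset.Icc_eq_empty (by omega)
        have h := sum_Icc_add_one_right (a := 1) (x := x - 1) (by omega) m
        rw [sub_add_cancel] at h
        rw [e1, e2, h]
        simp
    have e1 : m x * (lam x * (s x * M x) - mu x * (s (x - 1) * M (x - 1))) = M x - M (x - 1) := by
      linear_combination M x * h1 x - M (x - 1) * h2 x
    have e2 : lam x * (s x * M x) - mu x * (s (x - 1) * M (x - 1)) ≤ 1 := by
      by_contra! hlt
      nlinarith [mul_lt_mul_of_pos_left hlt (hm x)]
    calc _ = lam x * (intLyapunov m s (x + 1) - intLyapunov m s x) -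
          mu x * (intLyapunov m s x - intLyapunov m s (x - 1)) := by ring
      _ ≤ 1 := by rw [d1, d2]; exact e2
  · obtain ⟨k, hk⟩ := htop c
    obtain ⟨l, hl⟩ := hbot c
    refine (Set.finite_Icc l (k + 1)).subset fun x hx => ?_
    have hx : intLyapunov m s x ≤ c := hx
    constructor
    · by_contra! hxl
      have : ∑ j ∈ Finset.Icc l (-1), s j * ∑ i ∈ Finset.Icc (j + 1) (-1), m i ≤
          ∑ j ∈ Finset.Icc x (-1), s j * ∑ i ∈ Finset.Icc (j + 1) (-1), m i :=
        Finset.sum_le_sum_of_subset_of_nonneg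
          (Finset.Icc_subset_Icc_left hxl.le) fun j _ _ => hB j
      unfold intLyapunov at hx
      linarith [hA' x]
    · by_contra! hxk
      have : ∑ j ∈ Finset.Icc 1 k, s j * ∑ i ∈ Finset.Icc 1 j, m i ≤
          ∑ j ∈ Finset.Icc 1 (x - 1), s j * ∑ i ∈ Finset.Icc 1 j, m i :=
        Finset.sum_le_sum_of_subset_of_nonneg
          (Finset.Icc_subset_Icc_right (by omega)) fun j _ _ => hA j
      unfold intLyapunov at hx
      linarith [hB' x]

theorem exists_lt_sum_Icc_top {a : ℤ → ℝ} (ha : ∀ j, 0 ≤ a j)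
    (h : ∑' j : {j : ℤ // 1 ≤ j}, ENNReal.ofReal (a j) = ∞) (C : ℝ) :
    ∃ k : ℤ, C < ∑ j ∈ Finset.Icc 1 k, a j := by
  obtain ⟨S, hS⟩ := exists_lt_sum_of_tsum_ofReal_eq_top
    (a := fun j : {j : ℤ // 1 ≤ j} => a j) (fun j => ha j) h C
  obtain ⟨k, hk⟩ := (S.map (Function.Embedding.subtype _)).bddAbove
  refine ⟨k, hS.trans_le ?_⟩
  refine (Finset.sum_map S (Function.Embedding.subtype _) a).symm.trans_le ?_
  refine Finset.sum_le_sum_of_subset_of_nonneg (fun j hj => ?_) fun j _ _ => ha j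
  obtain ⟨i, -, rfl⟩ := Finset.mem_map.1 hj
  exact Finset.mem_Icc.2 ⟨i.2, hk hj⟩

theorem exists_lt_sum_Icc_bot {a : ℤ → ℝ} (ha : ∀ j, 0 ≤ a j)
    (h : ∑' j : {j : ℤ // j ≤ -1}, ENNReal.ofReal (a j) = ∞) (C : ℝ) :
    ∃ k : ℤ, C < ∑ j ∈ Finset.Icc k (-1), a j := by
  obtain ⟨S, hS⟩ := exists_lt_sum_of_tsum_ofReal_eq_top
    (a := fun j : {j : ℤ // j ≤ -1} => a j) (fun j => ha j) h C
  obtain ⟨k, hk⟩ := (S.map (Function.Embedding.subtype _)).bddBelow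
  refine ⟨k, hS.trans_le ?_⟩
  refine (Finset.sum_map S (Function.Embedding.subtype _) a).symm.trans_le ?_
  refine Finset.sum_le_sum_of_subset_of_nonneg (fun j hj => ?_) fun j _ _ => ha j
  obtain ⟨i, -, rfl⟩ := Finset.mem_map.1 hj
  exact Finset.mem_Icc.2 ⟨hk hj, i.2⟩

theorem ofReal_mul_sum {ι : Type*} {c : ℝ} (hc : 0 ≤ c) {a : ι → ℝ} (ha : ∀ i, 0 ≤ a i)
    (s : Finset ι) : ENNReal.ofReal c * ∑ i ∈ s, ENNReal.ofReal (a i) =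
      ENNReal.ofReal (c * ∑ i ∈ s, a i) := by
  rw [ENNReal.ofReal_mul hc, ENNReal.ofReal_sum_of_nonneg fun i _ => ha i]

theorem sum_Icc_comp_add_one (a b : ℤ) (F : ℤ → ℝ) :
    ∑ j ∈ Finset.Icc a b, F (j + 1) = ∑ j ∈ Finset.Icc (a + 1) (b + 1), F j :=
  Finset.sum_nbij' (· + 1) (· - 1) (fun j hj => by simp only [Finset.mem_Icc] at *; omega)
    (fun j hj => by simp only [Finset.mem_Icc] at *; omega) (fun j _ => by simp)
    (fun j _ => by simp) fun j _ => rfl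

namespace IsIntChain

variable {lam mu : ℤ → ℝ}

theorem symm_pos (h : IsIntChain lam mu) (x : ℤ) : 0 < intSymm lam mu x :=
  intSymm_pos h.lam_pos h.mu_pos x

theorem scale_pos (h : IsIntChain lam mu) (x : ℤ) : 0 < 1 / (lam x * intSymm lam mu x) :=
  one_div_pos.2 (mul_pos (h.lam_pos x) (h.symm_pos x))

theorem lam_mul_scale (h : IsIntChain lam mu) (x : ℤ) :
    lam x * intSymm lam mu x * (1 / (lam x * intSymm lam mu x)) = 1 :=
  mul_one_div_cancel (mul_pos (h.lam_pos x) (h.symm_pos x)).ne'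

theorem mu_mul_scale (h : IsIntChain lam mu) (x : ℤ) :
    mu (x + 1) * intSymm lam mu (x + 1) * (1 / (lam x * intSymm lam mu x)) = 1 := by
  rw [mul_comm (mu _), ← intSymm_mul h.lam_pos h.mu_pos, mul_comm (intSymm _ _ _), h.lam_mul_scale]

theorem isLyapunov (h : IsIntChain lam mu) : IsLyapunov (bdGenerator lam mu) intNbr
    (intLyapunov (intSymm lam mu) fun x => 1 / (lam x * intSymm lam mu x)) := by
  have hm := fun x => (h.symm_pos x).le
  have hs := fun x => (h.scale_pos x).le
  refine isLyapunov_int h.symm_pos h.scale_pos h.lam_mul_scale (fun x => ?_) ?_ ?_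
  · simpa using h.mu_mul_scale (x - 1)
  · refine exists_lt_sum_Icc_top (fun j => mul_nonneg (hs j) (Finset.sum_nonneg fun i _ => hm i)) ?_
    rw [← h.not_exit_top]
    exact tsum_congr fun j => (ofReal_mul_sum (hs j) hm _).symm
  · refine exists_lt_sum_Icc_bot (fun j => mul_nonneg (hs j) (Finset.sum_nonneg fun i _ => hm i)) ?_
    rw [← h.not_exit_bot]
    exact tsum_congr fun j => (ofReal_mul_sum (hs j) hm _).symm

/-- The Siegmund dual exchanges the roles of the symmetrizing measure and of the scale, so that its
Lyapunov function is made of the series which diverge because the boundary points are not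
entrance. -/
theorem isLyapunov_dual (h : IsIntChain lam mu) :
    IsLyapunov (bdGenerator (dualBirth lam mu) (dualDeath lam mu)) intNbr
      (intLyapunov (fun x => 1 / (lam x * intSymm lam mu x)) fun x => intSymm lam mu (x + 1)) := by
  have hm := fun x => (h.symm_pos x).le
  have hs := fun x => (h.scale_pos x).le
  refine isLyapunov_int h.scale_pos (fun x => h.symm_pos (x + 1)) (fun x => ?_) (fun x => ?_)
    (fun C => ?_) fun C => ?_
  · rw [dualBirth, mul_right_comm, h.mu_mul_scale]
  · rw [sub_add_cancel, dualDeath, mul_right_comm, h.lam_mul_scale]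
  · have hF := fun j : ℤ => mul_nonneg (hm j)
      (Finset.sum_nonneg fun i (_ : i ∈ Finset.Icc 1 (j - 1)) => hs i)
    obtain ⟨k, hk⟩ := exists_lt_sum_Icc_top hF (by
      rw [← h.not_entrance_top]
      exact tsum_congr fun j => (ofReal_mul_sum (hm j) hs _).symm) C
    refine ⟨k, hk.trans_le ?_⟩
    have h1 := sum_Icc_comp_add_one 1 k (fun j => intSymm lam mu j *
      ∑ i ∈ Finset.Icc 1 (j - 1), 1 / (lam i * intSymm lam mu i))
    simp only [add_sub_cancel_right] at h1
    rw [h1]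
    rcases lt_or_ge k 1 with hk1 | hk1
    · rw [Finset.Icc_eq_empty (by omega), Finset.sum_empty]
      exact Finset.sum_nonneg fun j _ => hF j
    · -- the term with index `1` is an empty sum
      rw [sum_Icc_eq_add_left hk1, sub_self, Finset.Icc_eq_empty (by omega : ¬ (1 : ℤ) ≤ 0),
        Finset.sum_empty, mul_zero, zero_add]
      exact Finset.sum_le_sum_of_subset_of_nonneg
        (Finset.Icc_subset_Icc_right (by omega)) fun j _ _ => hF j
  · have hF := fun j : ℤ => mul_nonneg (hm j)
      (Finset.sum_nonneg fun i (_ : i ∈ Finset.Icc j (-1)) => hs i)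
    obtain ⟨k, hk⟩ := exists_lt_sum_Icc_bot hF (by
      rw [← h.not_entrance_bot]
      exact tsum_congr fun j => (ofReal_mul_sum (hm j) hs _).symm) C
    refine ⟨k - 1, hk.trans_le ?_⟩
    rw [sum_Icc_comp_add_one (k - 1) (-1) (fun j => intSymm lam mu j *
      ∑ i ∈ Finset.Icc j (-1), 1 / (lam i * intSymm lam mu i))]
    exact Finset.sum_le_sum_of_subset_of_nonneg
      (Finset.Icc_subset_Icc (by omega) (by omega)) fun j _ _ => hF j

theorem intertwining (h : IsIntChain lam mu) (n : ℕ) {t : ℝ} (ht : 0 ≤ t) :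
    IsSubMarkovKernel (karlinMcGregor (bdDensity lam mu) n t) ∧
    IsSubMarkovKernel (karlinMcGregor (dualDensity lam mu) n t) ∧
    KernelsIntertwine
      (karlinMcGregor (bdDensity lam mu) (n + 1) t) (lambdaSucc (intSymmDual lam mu) n)
      (lambdaSucc (intSymmDual lam mu) n) (karlinMcGregor (dualDensity lam mu) n t) ∧
    KernelsIntertwine
      (karlinMcGregor (dualDensity lam mu) n t) (lambdaSame (intSymm lam mu) n)
      (lambdaSame (intSymm lam mu) n) (karlinMcGregor (bdDensity lam mu) n t) := by
  have hl : ∀ x, 0 < dualBirth lam mu x := fun x => h.mu_pos (x + 1)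
  have hm : ∀ x, 0 < dualDeath lam mu x := h.lam_pos
  exact karlinMcGregor_intertwining
    (isRateMatrix_int (fun x => (h.lam_pos x).le) fun x => (h.mu_pos x).le) h.isLyapunov
    (isRateMatrix_int (fun x => (hl x).le) fun x => (hm x).le) h.isLyapunov_dual
    intNbr_between intNbr_between (sum_intNbr_eq_zero lam mu) (bdGenerator_int_dual lam mu)
    h.symm_pos (bdGenerator_int_reversible (intSymm_mul h.lam_pos h.mu_pos))
    (intSymm_pos hl hm) (bdGenerator_int_reversible (intSymm_mul hl hm)) n ht

end IsIntChain

/-! ### Birth and death chains on the natural numbers -/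

/-- The states within distance one of a natural number. -/
def natNbr : ℕ → Finset ℕ
  | 0 => {1, 0}
  | x + 1 => {x + 2, x + 1, x}

theorem sum_natNbr_zero (lam mu a : ℕ → ℝ) : ∑ z ∈ natNbr 0, bdGenerator lam mu 0 z * a z =
    lam 0 * a 1 - (lam 0 + mu 0) * a 0 := by
  rw [natNbr, Finset.sum_insert (by simp), Finset.sum_singleton]
  have e1 : bdGenerator lam mu 0 1 = lam 0 := if_pos rfl
  have e2 : bdGenerator lam mu 0 0 = -(lam 0 + mu 0) := by
    rw [bdGenerator, if_neg (by omega), if_pos rfl]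
  rw [e1, e2]
  ring

theorem sum_natNbr_succ (lam mu a : ℕ → ℝ) (x : ℕ) :
    ∑ z ∈ natNbr (x + 1), bdGenerator lam mu (x + 1) z * a z =
      lam (x + 1) * a (x + 2) - (lam (x + 1) + mu (x + 1)) * a (x + 1) + mu (x + 1) * a x := by
  rw [natNbr, Finset.sum_insert, Finset.sum_insert, Finset.sum_singleton]
  · have e1 : bdGenerator lam mu (x + 1) (x + 2) = lam (x + 1) := if_pos rfl
    have e2 : bdGenerator lam mu (x + 1) (x + 1) = -(lam (x + 1) + mu (x + 1)) := by
      rw [bdGenerator, if_neg (by omega), if_pos rfl]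
    have e3 : bdGenerator lam mu (x + 1) x = mu (x + 1) := by
      rw [bdGenerator, if_neg (by omega), if_neg (by omega), if_pos rfl]
    rw [e1, e2, e3]
    ring
  · simp only [Finset.mem_singleton]
    omega
  · simp only [Finset.mem_insert, Finset.mem_singleton]
    omega

theorem isRateMatrix_nat {lam mu : ℕ → ℝ} (hl : ∀ x, 0 ≤ lam x) (hm : ∀ x, 0 ≤ mu x) :
    IsRateMatrix (bdGenerator lam mu) natNbr where
  self_mem x := by rcases x with _ | x <;> simp [natNbr]
  eq_zero x z hz := by
    rcases x with _ | x <;>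
    · simp only [natNbr, Finset.mem_insert, Finset.mem_singleton, not_or] at hz
      rw [bdGenerator, if_neg (by omega), if_neg (by omega), if_neg (by omega)]
  offdiag_nonneg x z hz := by
    rw [bdGenerator, if_neg hz]
    split_ifs
    exacts [hl x, hm x, le_rfl]
  row_sum_nonpos x := by
    rcases x with _ | x
    · have h := sum_natNbr_zero lam mu (fun _ => 1)
      simp only [mul_one] at h
      rw [h]
      linarith [hm 0]
    · have h := sum_natNbr_succ lam mu (fun _ => 1) x
      simp only [mul_one] at h
      rw [h]
      linarith

theorem sum_natNbr_eq_zero {lam mu : ℕ → ℝ} (hmu : mu 0 = 0) (x : ℕ) :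
    ∑ z ∈ natNbr x, bdGenerator lam mu x z = 0 := by
  rcases x with _ | x
  · have h := sum_natNbr_zero lam mu (fun _ => 1)
    simp only [mul_one] at h
    rw [h, hmu]
    ring
  · have h := sum_natNbr_succ lam mu (fun _ => 1) x
    simp only [mul_one] at h
    rw [h]
    ring

theorem natNbr_between (x y z : ℕ) (hz : z ∈ natNbr x) : (x < y → z ≤ y) ∧ (y < x → y ≤ z) := by
  rcases x with _ | x <;>
  · simp only [natNbr, Finset.mem_insert, Finset.mem_singleton] at hz
    omega

theorem bdGenerator_nat_reversible {lam mu m : ℕ → ℝ}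
    (h : ∀ x, m x * lam x = m (x + 1) * mu (x + 1)) (x y : ℕ) :
    m x * bdGenerator lam mu x y = m y * bdGenerator lam mu y x := by
  simp only [bdGenerator]
  rcases lt_trichotomy x y with hxy | rfl | hxy
  · by_cases h1 : y = x + 1
    · subst h1
      rw [if_pos rfl, if_neg (by omega), if_neg (by omega), if_pos rfl, h x]
    · rw [if_neg h1, if_neg (by omega), if_neg (by omega), if_neg (by omega), if_neg (by omega),
        if_neg h1, mul_zero, mul_zero]
  · rfl
  · by_cases h1 : x = y + 1
    · subst h1
      rw [if_neg (by omega), if_neg (by omega), if_pos rfl, if_pos rfl, h y]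
    · rw [if_neg (by omega), if_neg (by omega), if_neg h1, if_neg h1, if_neg (by omega),
        if_neg (by omega), mul_zero, mul_zero]

theorem bdGenerator_nat_dual {lam mu : ℕ → ℝ} (hmu : mu 0 = 0) (x v : ℕ) :
    ∑ w ∈ natNbr v, bdGenerator (dualBirth lam mu) (dualDeath lam mu) v w *
      (if x ≤ w then 1 else 0) =
    ∑ z ∈ natNbr x, bdGenerator lam mu x z * (if z ≤ v then 1 else 0) := by
  rcases v with _ | v
  · rw [sum_natNbr_zero _ _ (fun w => if x ≤ w then (1 : ℝ) else 0)]
    rcases x with _ | x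
    · rw [sum_natNbr_zero _ _ (fun z => if z ≤ 0 then (1 : ℝ) else 0)]
      simp [dualBirth, dualDeath, hmu]
    · rw [sum_natNbr_succ _ _ (fun z => if z ≤ 0 then (1 : ℝ) else 0)]
      rcases x with _ | x <;> simp [dualBirth, dualDeath]
  · rw [sum_natNbr_succ _ _ (fun w => if x ≤ w then (1 : ℝ) else 0)]
    rcases x with _ | x
    · rw [sum_natNbr_zero _ _ (fun z => if z ≤ v + 1 then (1 : ℝ) else 0)]
      simp [dualBirth, dualDeath, hmu]
    · rw [sum_natNbr_succ _ _ (fun z => if z ≤ v + 1 then (1 : ℝ) else 0)]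
      simp only [dualBirth, dualDeath]
      rcases lt_trichotomy x v with h | rfl | h
      · simp only [show x + 1 ≤ v + 2 by omega, show x + 1 ≤ v + 1 by omega,
          show x + 1 ≤ v by omega, show x + 2 ≤ v + 1 by omega, show x ≤ v + 1 by omega, if_true]
        ring
      · simp only [show x + 1 ≤ x + 2 by omega, show x + 1 ≤ x + 1 by omega,
          show ¬ x + 1 ≤ x by omega, show ¬ x + 2 ≤ x + 1 by omega, show x ≤ x + 1 by omega,
          if_true, if_false]
        ring
      · by_cases h1 : x = v + 1
        · subst h1
          simp only [show v + 1 + 1 ≤ v + 2 by omega, show ¬ v + 1 + 1 ≤ v + 1 by omega,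
            show ¬ v + 1 + 1 ≤ v by omega, show ¬ v + 1 + 2 ≤ v + 1 by omega,
            show v + 1 ≤ v + 1 by omega, if_true, if_false]
          ring
        · simp only [show ¬ x + 1 ≤ v + 2 by omega, show ¬ x + 1 ≤ v + 1 by omega,
            show ¬ x + 1 ≤ v by omega, show ¬ x + 2 ≤ v + 1 by omega, show ¬ x ≤ v + 1 by omega,
            if_false]
          ring

theorem natSymm_pos {lam mu : ℕ → ℝ} (hl : ∀ x, 0 < lam x) (hm : ∀ x, 0 < mu (x + 1)) (x : ℕ) :
    0 < natSymm lam mu x :=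
  Finset.prod_pos fun i _ => div_pos (hl i) (hm i)

theorem natSymm_mul {lam mu : ℕ → ℝ} (hm : ∀ x, 0 < mu (x + 1)) (x : ℕ) :
    natSymm lam mu x * lam x = natSymm lam mu (x + 1) * mu (x + 1) := by
  have := (hm x).ne'
  rw [natSymm, natSymm, Finset.prod_range_succ]
  field_simp

/-- The function with increments `s_x ∑_{i ≤ x} m_i`, for which `Q f ≤ 1`. -/
noncomputable def natLyapunov (m s : ℕ → ℝ) (x : ℕ) : ℝ :=
  1 + ∑ j ∈ Finset.range x, s j * ∑ i ∈ Finset.range (j + 1), m i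

theorem isLyapunov_nat {lam mu m s : ℕ → ℝ} (hm : ∀ x, 0 < m x) (hs : ∀ x, 0 < s x)
    (hmu : 0 ≤ mu 0)
    (h1 : ∀ x, lam x * m x * s x = 1) (h2 : ∀ x, mu (x + 1) * m (x + 1) * s x = 1)
    (htop : ∑' j, ENNReal.ofReal (s j) * ∑ i ∈ Finset.range (j + 1), ENNReal.ofReal (m i) = ∞) :
    IsLyapunov (bdGenerator lam mu) natNbr (natLyapunov m s) := by
  have hA : ∀ j, 0 ≤ s j * ∑ i ∈ Finset.range (j + 1), m i := fun j =>
    mul_nonneg (hs j).le (Finset.sum_nonneg fun i _ => (hm i).le)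
  have hone : ∀ x, 1 ≤ natLyapunov m s x := fun x =>
    le_add_of_nonneg_right (Finset.sum_nonneg fun j _ => hA j)
  have hstep : ∀ x, natLyapunov m s (x + 1) - natLyapunov m s x =
      s x * ∑ i ∈ Finset.range (x + 1), m i := fun x => by
    rw [natLyapunov, natLyapunov, Finset.sum_range_succ]
    ring
  refine ⟨fun x => zero_le_one.trans (hone x), fun x => le_trans ?_ (hone x), fun c => ?_⟩
  · rcases x with _ | x
    · have h := hstep 0
      simp only [zero_add, Finset.range_one, Finset.sum_singleton] at h
      rw [sum_natNbr_zero]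
      calc _ = lam 0 * (natLyapunov m s 1 - natLyapunov m s 0) - mu 0 * natLyapunov m s 0 := by ring
        _ = 1 - mu 0 * natLyapunov m s 0 := by
          rw [h]
          linear_combination h1 0
        _ ≤ 1 := sub_le_self _ (mul_nonneg hmu (zero_le_one.trans (hone 0)))
    · rw [sum_natNbr_succ]
      refine le_of_eq (mul_left_cancel₀ (hm (x + 1)).ne' ?_)
      have e1 := hstep x
      have e2 := hstep (x + 1)
      rw [Finset.sum_range_succ] at e2
      linear_combination m (x + 1) * lam (x + 1) * e2 - m (x + 1) * mu (x + 1) * e1 +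
        (∑ i ∈ Finset.range (x + 1), m i + m (x + 1)) * h1 (x + 1) -
        (∑ i ∈ Finset.range (x + 1), m i) * h2 x
  · have htop' : ∑' j, ENNReal.ofReal (s j * ∑ i ∈ Finset.range (j + 1), m i) = ∞ := by
      rw [← htop]
      exact tsum_congr fun j => by
        rw [ENNReal.ofReal_mul (hs j).le, ENNReal.ofReal_sum_of_nonneg fun i _ => (hm i).le]
    obtain ⟨S, hS⟩ := exists_lt_sum_of_tsum_ofReal_eq_top hA htop' c
    obtain ⟨k, hk⟩ := S.bddAbove
    refine (Set.finite_Iic k).subset fun x hx => ?_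
    by_contra! hxk
    have hx : natLyapunov m s x ≤ c := hx
    have hxk : k < x := not_le.1 hxk
    have : ∑ j ∈ S, s j * ∑ i ∈ Finset.range (j + 1), m i ≤
        ∑ j ∈ Finset.range x, s j * ∑ i ∈ Finset.range (j + 1), m i :=
      Finset.sum_le_sum_of_subset_of_nonneg
        (fun j hj => Finset.mem_range.2 ((hk hj).trans_lt hxk)) fun j _ _ => hA j
    unfold natLyapunov at hx
    linarith

/-- Tonelli's theorem for a double sum over `i < k`. -/
theorem tsum_mul_tsum_add_eq (a b : ℕ → ℝ≥0∞) : ∑' j, a j * ∑' i, b (j + 1 + i) =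
    ∑' k, b (k + 1) * ∑ j ∈ Finset.range (k + 1), a j := by
  simp only [← ENNReal.tsum_mul_left]
  rw [← ENNReal.tsum_prod (f := fun j i => a j * b (j + 1 + i)),
    ← Finset.HasAntidiagonal.sigmaAntidiagonalEquivProd.tsum_eq, ENNReal.tsum_sigma']
  refine tsum_congr fun k => ?_
  rw [tsum_fintype, Finset.mul_sum]
  refine (Finset.sum_coe_sort (Finset.HasAntidiagonal.antidiagonal k)
    fun c => a c.1 * b (c.1 + 1 + c.2)).trans ?_
  rw [Finset.Nat.sum_antidiagonal_eq_sum_range_succ (fun i j => a i * b (i + 1 + j))]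
  refine Finset.sum_congr rfl fun j hj => ?_
  rw [mul_comm, show j + 1 + (k - j) = k + 1 by have := Finset.mem_range.1 hj; omega]

namespace IsNatChain

variable {lam mu : ℕ → ℝ}

theorem mu_succ_pos (h : IsNatChain lam mu) (x : ℕ) : 0 < mu (x + 1) := h.mu_pos _ (by omega)

theorem symm_pos (h : IsNatChain lam mu) (x : ℕ) : 0 < natSymm lam mu x :=
  natSymm_pos h.lam_pos h.mu_succ_pos x

theorem scale_pos (h : IsNatChain lam mu) (x : ℕ) : 0 < 1 / (lam x * natSymm lam mu x) :=
  one_div_pos.2 (mul_pos (h.lam_pos x) (h.symm_pos x))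

theorem lam_mul_scale (h : IsNatChain lam mu) (x : ℕ) :
    lam x * natSymm lam mu x * (1 / (lam x * natSymm lam mu x)) = 1 :=
  mul_one_div_cancel (mul_pos (h.lam_pos x) (h.symm_pos x)).ne'

theorem mu_mul_scale (h : IsNatChain lam mu) (x : ℕ) :
    mu (x + 1) * natSymm lam mu (x + 1) * (1 / (lam x * natSymm lam mu x)) = 1 := by
  rw [mul_comm (mu _), ← natSymm_mul h.mu_succ_pos, mul_comm (natSymm _ _ _), h.lam_mul_scale]

theorem isLyapunov (h : IsNatChain lam mu) : IsLyapunov (bdGenerator lam mu) natNbr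
    (natLyapunov (natSymm lam mu) fun x => 1 / (lam x * natSymm lam mu x)) :=
  isLyapunov_nat h.symm_pos h.scale_pos h.mu_zero.ge h.lam_mul_scale h.mu_mul_scale h.not_exit

theorem isLyapunov_dual (h : IsNatChain lam mu) :
    IsLyapunov (bdGenerator (dualBirth lam mu) (dualDeath lam mu)) natNbr
      (natLyapunov (fun x => 1 / (lam x * natSymm lam mu x)) fun x => natSymm lam mu (x + 1)) := by
  refine isLyapunov_nat h.scale_pos (fun x => h.symm_pos (x + 1)) (h.lam_pos 0).le (fun x => ?_)
    (fun x => ?_) ?_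
  · rw [dualBirth, mul_right_comm, h.mu_mul_scale]
  · rw [dualDeath, mul_right_comm, h.lam_mul_scale]
  · rw [← h.not_entrance]
    exact (tsum_mul_tsum_add_eq (fun j => ENNReal.ofReal (1 / (lam j * natSymm lam mu j)))
      fun j => ENNReal.ofReal (natSymm lam mu j)).symm

theorem intertwining (h : IsNatChain lam mu) (n : ℕ) {t : ℝ} (ht : 0 ≤ t) :
    IsSubMarkovKernel (karlinMcGregor (bdDensity lam mu) n t) ∧
    IsSubMarkovKernel (karlinMcGregor (dualDensity lam mu) n t) ∧
    KernelsIntertwine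
      (karlinMcGregor (bdDensity lam mu) (n + 1) t) (lambdaSucc (natSymmDual lam mu) n)
      (lambdaSucc (natSymmDual lam mu) n) (karlinMcGregor (dualDensity lam mu) n t) ∧
    KernelsIntertwine
      (karlinMcGregor (dualDensity lam mu) n t) (lambdaSame (natSymm lam mu) n)
      (lambdaSame (natSymm lam mu) n) (karlinMcGregor (bdDensity lam mu) n t) := by
  have hl : ∀ x, 0 < dualBirth lam mu x := fun x => h.mu_succ_pos x
  have hm : ∀ x, 0 < dualDeath lam mu x := h.lam_pos
  have hmu : ∀ x, 0 ≤ mu x := fun x => by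
    rcases x with _ | x
    · exact h.mu_zero.ge
    · exact (h.mu_succ_pos x).le
  exact karlinMcGregor_intertwining
    (isRateMatrix_nat (fun x => (h.lam_pos x).le) hmu) h.isLyapunov
    (isRateMatrix_nat (fun x => (hl x).le) fun x => (hm x).le) h.isLyapunov_dual
    natNbr_between natNbr_between (sum_natNbr_eq_zero h.mu_zero) (bdGenerator_nat_dual h.mu_zero)
    h.symm_pos (bdGenerator_nat_reversible (natSymm_mul h.mu_succ_pos))
    (natSymm_pos hl fun x => hm (x + 1))
    (bdGenerator_nat_reversible (natSymm_mul fun x => hm (x + 1))) n ht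

end IsNatChain

theorem theorem1p1 :
    (∀ lam mu : ℕ → ℝ, IsNatChain lam mu → ∀ (n : ℕ) (t : ℝ), 0 ≤ t →
      IsSubMarkovKernel (karlinMcGregor (bdDensity lam mu) n t) ∧
      IsSubMarkovKernel (karlinMcGregor (dualDensity lam mu) n t) ∧
      KernelsIntertwine
        (karlinMcGregor (bdDensity lam mu) (n + 1) t) (lambdaSucc (natSymmDual lam mu) n)
        (lambdaSucc (natSymmDual lam mu) n) (karlinMcGregor (dualDensity lam mu) n t) ∧
      KernelsIntertwine
        (karlinMcGregor (dualDensity lam mu) n t) (lambdaSame (natSymm lam mu) n)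
        (lambdaSame (natSymm lam mu) n) (karlinMcGregor (bdDensity lam mu) n t)) ∧
    (∀ lam mu : ℤ → ℝ, IsIntChain lam mu → ∀ (n : ℕ) (t : ℝ), 0 ≤ t →
      IsSubMarkovKernel (karlinMcGregor (bdDensity lam mu) n t) ∧
      IsSubMarkovKernel (karlinMcGregor (dualDensity lam mu) n t) ∧
      KernelsIntertwine
        (karlinMcGregor (bdDensity lam mu) (n + 1) t) (lambdaSucc (intSymmDual lam mu) n)
        (lambdaSucc (intSymmDual lam mu) n) (karlinMcGregor (dualDensity lam mu) n t) ∧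
      KernelsIntertwine
        (karlinMcGregor (dualDensity lam mu) n t) (lambdaSame (intSymm lam mu) n)
        (lambdaSame (intSymm lam mu) n) (karlinMcGregor (bdDensity lam mu) n t)) := by
  exact ⟨fun _ _ h n _ ht => h.intertwining n ht, fun _ _ h n _ ht => h.intertwining n ht⟩
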